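/- An oracle is a set $A\subseteq\{0,1\}^{<\omega}$ of finite binary strings. For an oracle $A$, let $\mathbf{P}^A$ (respectively $\mathbf{NP}^A$) be the class of languages $L\subseteq\{0,1\}^{<\omega}$ decided by a deterministic (respectively nondeterministic) multi-tape oracle Turing machine that, with oracle $A$, halts on every computation path within a number of steps bounded by a polynomial in the input length; a nondeterministic machine decides $L$ if, for every input $x$, $x\in L$ if and only if some computation path on $x$ accepts. $\mathbf{P}$ and $\mathbf{NP}$ are the corresponding classes for machines without an oracle. Let $\mathbf{O}=\{A : \mathbf{P}^A\neq\mathbf{NP}^A\}$. Let $[\omega]^\omega$ be the set of infinite subsets of $\omega$, with the Ellentuck topology, whose basic open sets are $$[a,A]=\{S\in[\omega]^\omega : S\setminus A=a \text{ and } S\setminus a\subseteq A\},$$ where $a\subseteq\omega$ is finite and $A\subseteq\omega\setminus a$ is infinite. A subset of $[\omega]^\omega$ is called Ramsey large if it is comeager in this topology. Fix an enumeration without repetition $s_0,s_1,\dots$ of all finite binary strings, and identify $S\in[\omega]^\omega$ with the infinite oracle $\{s_i : i\in S\}$. Theorem. If the set of all $S\in[\omega]^\omega$ with $\{s_i : i\in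 S\}\in\mathbf{O}$ is Ramsey large, then $\mathbf{P}\neq\mathbf{NP}$. -/

import Mathlib

/-! ### Oracle Turing machines -/

/-- One elementary action of a multi-tape machine with states `Q`, tape symbols `Γ` and tapes
indexed by `ι`: the next state, the symbol written on each tape, the move of each head
(`none` means that the head stays), and possibly a bit appended on the query tape. -/
structure TMAction (Q Γ ι : Type) where
  next : Q
  write : ι → Γ
  move : ι → Option Turing.Dir
  emit : Option Bool

/-- A (nondeterministic) multi-tape Turing machine with finitely many states, tape symbols and
two-way infinite tapes, together with a write-only query tape over `{0, 1}`.
The blank symbol is `default`.  A state `q` with `ask q = some f` is a query state: the machine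
moves to the state `f true` or `f false` according to whether the word on the query tape belongs
to the oracle, and the query tape is erased.  In every other state, `trans` gives the set of
actions available for the scanned symbols. -/
structure OracleTM where
  State : Type
  Symbol : Type
  Tape : Type
  [finState : Finite State]
  [finSymbol : Finite Symbol]
  [finTape : Finite Tape]
  [blank : Inhabited Symbol]
  /-- The tape symbols standing for the letters `0` and `1`. -/
  bit : Bool → Symbol
  bit_injective : Function.Injective bit
  bit_ne_blank : ∀ b, bit b ≠ default
  inputTape : Tape
  start : State
  accept : Set State
  ask : State → Option (Bool → State)
  trans : State → (Tape → Symbol) → Set (TMAction State Symbol Tape)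

namespace OracleTM

instance (M : OracleTM) : Inhabited M.Symbol := M.blank

/-- A configuration: the state, the tapes with their heads, the word on the query tape. -/
structure Cfg (M : OracleTM) where
  state : M.State
  tape : M.Tape → Turing.Tape M.Symbol
  query : List Bool

/-- Write a symbol at the head, then move the head. -/
def actTape {Γ : Type} [Inhabited Γ] (T : Turing.Tape Γ) (s : Γ) :
    Option Turing.Dir → Turing.Tape Γ
  | none => T.write s
  | some d => (T.write s).move d

/-- The configuration resulting from an action. -/
def act (M : OracleTM) (c : M.Cfg) (a : TMAction M.State M.Symbol M.Tape) : M.Cfg where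
  state := a.next
  tape := fun i => actTape (c.tape i) (a.write i) (a.move i)
  query := c.query ++ a.emit.toList

open Classical in
/-- The set of successors of a configuration, relative to the oracle `A`. -/
noncomputable def succs (M : OracleTM) (A : Language Bool) (c : M.Cfg) : Set M.Cfg :=
  match M.ask c.state with
  | some f => {⟨f (decide (c.query ∈ A)), c.tape, []⟩}
  | none => M.act c '' M.trans c.state (fun i => (c.tape i).head)

open Classical in
/-- The initial configuration: the input is on the input tape with the head on its first letter,
and all other tapes are blank. -/
noncomputable def init (M : OracleTM) (x : List Bool) : M.Cfg where
  state := M.start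
  tape := fun i => if i = M.inputTape then Turing.Tape.mk₁ (x.map M.bit) else Turing.Tape.mk₁ []
  query := []

/-- `c'` can be reached from `c` in exactly `n` steps, relative to the oracle `A`. -/
def ReachIn (M : OracleTM) (A : Language Bool) : ℕ → M.Cfg → M.Cfg → Prop
  | 0, c, c' => c = c'
  | n + 1, c, c' => ∃ d ∈ M.succs A c, M.ReachIn A n d c'

/-- Some computation on input `x` relative to `A` halts in an accepting state. -/
def Accepts (M : OracleTM) (A : Language Bool) (x : List Bool) : Prop :=
  ∃ n c, M.ReachIn A n (M.init x) c ∧ M.succs A c = ∅ ∧ c.state ∈ M.accept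

/-- Every computation on input `x` relative to `A` halts after at most `t` steps. -/
def HaltsWithin (M : OracleTM) (A : Language Bool) (x : List Bool) (t : ℕ) : Prop :=
  ∀ n c, M.ReachIn A n (M.init x) c → n ≤ t

/-- Relative to `A`, the machine runs in polynomial time and decides the language `L`. -/
def DecidesInPolyTime (M : OracleTM) (A L : Language Bool) : Prop :=
  (∃ p : Polynomial ℕ, ∀ x : List Bool, M.HaltsWithin A x (p.eval x.length)) ∧
    ∀ x : List Bool, x ∈ L ↔ M.Accepts A x

/-- A deterministic machine: at most one action is available in each situation. -/
def Deterministic (M : OracleTM) : Prop :=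
  ∀ q s, (M.trans q s).Subsingleton

/-- An ordinary Turing machine: there are no query states, so no oracle is ever consulted. -/
def OracleFree (M : OracleTM) : Prop :=
  ∀ q, M.ask q = none

end OracleTM

/-! ### The classes `P`, `NP` and their relativizations -/

/-- The class `P^A`. -/
def classPRel (A : Language Bool) : Set (Language Bool) :=
  {L | ∃ M : OracleTM, M.Deterministic ∧ M.DecidesInPolyTime A L}

/-- The class `NP^A`. -/
def classNPRel (A : Language Bool) : Set (Language Bool) :=
  {L | ∃ M : OracleTM, M.DecidesInPolyTime A L}

/-- The class `P`: languages decided in polynomial time by a deterministic machine without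
oracle.  (The oracle argument `∅` is never consulted.) -/
def classP : Set (Language Bool) :=
  {L | ∃ M : OracleTM, M.OracleFree ∧ M.Deterministic ∧ M.DecidesInPolyTime (∅ : Set (List Bool)) L}

/-- The class `NP`: languages decided in polynomial time by a nondeterministic machine without
oracle.  (The oracle argument `∅` is never consulted.) -/
def classNP : Set (Language Bool) :=
  {L | ∃ M : OracleTM, M.OracleFree ∧ M.DecidesInPolyTime (∅ : Set (List Bool)) L}

/-- The set of oracles separating `P` and `NP`. -/
def separatingOracles : Set (Language Bool) :=
  {A | classPRel A ≠ classNPRel A}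

/-! ### The Ellentuck topology -/

/-- The space `[ω]^ω` of infinite sets of natural numbers. -/
def EllentuckSpace : Type := {S : Set ℕ // S.Infinite}

namespace EllentuckSpace

/-- The basic set `[a, A] = {S | S \ A = a ∧ S \ a ⊆ A}`. -/
def basic (a : Finset ℕ) (A : Set ℕ) : Set EllentuckSpace :=
  {S | S.1 \ A = ↑a ∧ S.1 \ ↑a ⊆ A}

/-- The Ellentuck topology, generated by the sets `[a, A]` with `a` finite, `A` infinite and
`A` disjoint from `a`. -/
instance : TopologicalSpace EllentuckSpace :=
  TopologicalSpace.generateFrom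
    {U | ∃ (a : Finset ℕ) (A : Set ℕ), A.Infinite ∧ Disjoint (↑a : Set ℕ) A ∧ U = basic a A}

end EllentuckSpace

/-- Ramsey large sets: those which are comeager in the Ellentuck topology. -/
def RamseyLarge (X : Set EllentuckSpace) : Prop :=
  IsMeagre Xᶜ

/-- The oracle coded by an infinite set of natural numbers via an enumeration `e` of all words. -/
def oracleOf (e : ℕ ≃ List Bool) (S : EllentuckSpace) : Language Bool :=
  (e '' S.1 : Set (List Bool))

/-! ### The Ellentuck topology is Baire -/

namespace EllentuckSpace

/-! The infinite sets of indices of words `0 ⋯ 0` form a nonempty open set in the Ellentuck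
topology. This topology is Baire, by a fusion argument, so a comeager set meets that open set
(`RamseyLarge.exists_subset`). If the separating oracles were Ramsey large, some infinite tally
oracle would therefore be separating. It remains to see that P = NP forbids this
(`classPRel_eq_classNPRel_of_isTally`).

Let `A` be tally and let `N` decide `L` nondeterministically with oracle `A` in time `p`. On input
`x` only queries of length at most `p(|x|)` occur, and of these only the words `0 ⋯ 0` can lie in
`A`. A polynomially long table `t` of answers thus holds all that the oracle can contribute. The
oracle-free `tableMachine` simulates `N` on a code of `x` and `t`. It uses its own input as a clock,
so it runs in linear time on every word, well-formed or not (`haltsWithin_tableMachine`), and the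
language it accepts is in NP. For a correct and long enough table it agrees with `N`
(`accepts_tableMachine_iff`).

If P = NP, a deterministic oracle-free machine `D` decides the same language. The deterministic
`fillMachine` asks `A` for the words `0 ⋯ 0` in order of length, writes the code of `x` and `t`, and
runs `D` on it (`detReach_fillMachine`, `acceptsFrom_map_iff`, `HaltsFrom.map`). It need not
evaluate `p`: the table has length `(|x| + 2) ^ k` for a fixed `k`, counted off by `k` counters, and
some such power dominates any given polynomial (`exists_pow_bound`). -/

theorem mem_basic_iff {a : Finset ℕ} {A : Set ℕ} (h : Disjoint (↑a : Set ℕ) A)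
    {S : EllentuckSpace} : S ∈ basic a A ↔ (↑a : Set ℕ) ⊆ S.1 ∧ S.1 ⊆ ↑a ∪ A := by
  constructor
  · rintro ⟨h₁, h₂⟩
    exact ⟨h₁ ▸ Set.sdiff_subset, Set.sdiff_subset_iff.1 h₂⟩
  · rintro ⟨h₁, h₂⟩
    refine ⟨Set.Subset.antisymm ?_ ?_, Set.sdiff_subset_iff.2 h₂⟩
    · rintro x ⟨hx, hxA⟩
      exact (h₂ hx).resolve_right hxA
    · exact fun x hx => ⟨h₁ hx, Set.disjoint_left.1 h hx⟩

/-- Every neighbourhood of `S` contains all infinite subsets of `S` extending some finite part. -/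
theorem exists_finset_of_isOpen {U : Set EllentuckSpace} (hU : IsOpen U) {S : EllentuckSpace}
    (hS : S ∈ U) : ∃ c : Finset ℕ, (↑c : Set ℕ) ⊆ S.1 ∧
      ∀ X : EllentuckSpace, (↑c : Set ℕ) ⊆ X.1 → X.1 ⊆ S.1 → X ∈ U := by
  induction hU with
  | basic U hU =>
    obtain ⟨a, A, -, hd, rfl⟩ := hU
    rw [mem_basic_iff hd] at hS
    refine ⟨a, hS.1, fun X h₁ h₂ => ?_⟩
    rw [mem_basic_iff hd]
    exact ⟨h₁, h₂.trans hS.2⟩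
  | univ => exact ⟨∅, by simp, fun X _ _ => trivial⟩
  | inter U V _ _ ihU ihV =>
    obtain ⟨c, hc, hcU⟩ := ihU hS.1
    obtain ⟨d, hd, hdV⟩ := ihV hS.2
    refine ⟨c ∪ d, by simp [hc, hd], fun X h₁ h₂ => ?_⟩
    rw [Finset.coe_union, Set.union_subset_iff] at h₁
    exact ⟨hcU X h₁.1 h₂, hdV X h₁.2 h₂⟩
  | sUnion 𝒰 _ ih =>
    obtain ⟨U, hU, hSU⟩ := hS
    obtain ⟨c, hc, hcU⟩ := ih U hU hSU
    exact ⟨c, hc, fun X h₁ h₂ => ⟨U, hU, hcU X h₁ h₂⟩⟩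

/-- The infinite sets between a finite set and `S` form an open set. -/
theorem isOpen_between (c : Finset ℕ) (S : EllentuckSpace) (hc : (↑c : Set ℕ) ⊆ S.1) :
    IsOpen {X : EllentuckSpace | (↑c : Set ℕ) ⊆ X.1 ∧ X.1 ⊆ S.1} := by
  refine TopologicalSpace.isOpen_generateFrom_of_mem
    ⟨c, S.1 \ ↑c, S.2.sdiff c.finite_toSet, Set.disjoint_sdiff_right, ?_⟩
  ext X
  rw [mem_basic_iff Set.disjoint_sdiff_right, Set.union_sdiff_cancel hc]
  rfl

/-- One step of the construction of a point in a countable intersection of dense open sets. -/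
theorem exists_refinement {U : Set EllentuckSpace} (hU : IsOpen U) (hd : Dense U)
    (c : Finset ℕ) (S : EllentuckSpace) (hc : (↑c : Set ℕ) ⊆ S.1) :
    ∃ (d : Finset ℕ) (T : EllentuckSpace), (↑d : Set ℕ) ⊆ T.1 ∧ c ⊂ d ∧ T.1 ⊆ S.1 ∧
      ∀ X : EllentuckSpace, (↑d : Set ℕ) ⊆ X.1 → X.1 ⊆ T.1 → X ∈ U := by
  obtain ⟨T, ⟨hcT, hTS⟩, hTU⟩ :=
    hd.inter_open_nonempty _ (isOpen_between c S hc) ⟨S, hc, subset_rfl⟩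
  obtain ⟨b, hbT, hb⟩ := exists_finset_of_isOpen hU hTU
  -- The extra point `m` makes the finite part grow strictly, so that the limit of the construction
  -- is infinite.
  obtain ⟨m, hmT, hm⟩ := T.2.exists_notMem_finset c
  refine ⟨insert m (c ∪ b), T, ?_, ?_, hTS, fun X h₁ h₂ => hb X (subset_trans ?_ h₁) h₂⟩
  · simp [Set.insert_subset_iff, hmT, hcT, hbT]
  · refine (Finset.ssubset_iff_of_subset fun x hx => ?_).2 ⟨m, by simp, hm⟩
    simp [hx]
  · intro x hx
    simp only [Finset.coe_insert, Finset.coe_union]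
    exact Or.inr (Or.inr hx)

/-- Fusion: the finite parts of the stages increase strictly and the infinite sets decrease. The
union of the finite parts is infinite and lies between the two components of every stage, hence in
every dense open set and in `V`. -/
instance : BaireSpace EllentuckSpace where
  baire_property f ho hd := by
    rw [dense_iff_inter_open]
    rintro V hV ⟨S₀, hS₀⟩
    obtain ⟨c₀, hc₀, hV₀⟩ := exists_finset_of_isOpen hV hS₀
    let Stage := {p : Finset ℕ × EllentuckSpace // (↑p.1 : Set ℕ) ⊆ p.2.1}
    have step : ∀ (n : ℕ) (p : Stage), ∃ q : Stage, p.1.1 ⊂ q.1.1 ∧ q.1.2.1 ⊆ p.1.2.1 ∧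
        ∀ X : EllentuckSpace, (↑q.1.1 : Set ℕ) ⊆ X.1 → X.1 ⊆ q.1.2.1 → X ∈ f n := by
      rintro n ⟨⟨c, S⟩, hc⟩
      obtain ⟨d, T, hdT, hcd, hTS, h⟩ := exists_refinement (ho n) (hd n) c S hc
      exact ⟨⟨⟨d, T⟩, hdT⟩, hcd, hTS, h⟩
    choose next hnext₁ hnext₂ hnext₃ using step
    let seq : ℕ → Stage := fun n => Nat.rec ⟨(c₀, S₀), hc₀⟩ next n
    have hmono : StrictMono fun n => (seq n).1.1 := strictMono_nat_of_lt_succ fun n =>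
      hnext₁ n (seq n)
    have hanti : Antitone fun n => (seq n).1.2.1 := antitone_nat_of_succ_le fun n =>
      hnext₂ n (seq n)
    have hinf : (⋃ n, (↑(seq n).1.1 : Set ℕ)).Infinite := by
      refine Set.infinite_of_not_bddAbove fun ⟨B, hB⟩ => ?_
      have hsub : ∀ n, (seq n).1.1 ⊆ Finset.range (B + 1) := fun n x hx =>
        Finset.mem_range_succ_iff.2 (hB (Set.mem_iUnion.2 ⟨n, hx⟩))
      have hcard : StrictMono fun n => (seq n).1.1.card :=
        fun m n h => Finset.card_lt_card (hmono h)
      have h₁ := hcard.id_le (B + 2)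
      have h₂ := Finset.card_le_card (hsub (B + 2))
      simp only [Finset.card_range, id] at h₁ h₂
      omega
    have hlow : ∀ n, (↑(seq n).1.1 : Set ℕ) ⊆ ⋃ n, (↑(seq n).1.1 : Set ℕ) := fun n =>
      Set.subset_iUnion (fun n => (↑(seq n).1.1 : Set ℕ)) n
    have hupp : ∀ n, (⋃ n, (↑(seq n).1.1 : Set ℕ)) ⊆ (seq n).1.2.1 := by
      refine fun n => Set.iUnion_subset fun m x hx => ?_
      have h₁ : x ∈ (seq (max m n)).1.1 := hmono.monotone (le_max_left m n) hx
      exact hanti (le_max_right m n) ((seq (max m n)).2 h₁)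
    refine ⟨⟨_, hinf⟩, hV₀ _ (hlow 0) (hupp 0), Set.mem_iInter.2 fun n => ?_⟩
    exact hnext₃ n (seq n) _ (hlow (n + 1)) (hupp (n + 1))

end EllentuckSpace

/-- A Ramsey large set contains an infinite subset of any given infinite set. -/
theorem RamseyLarge.exists_subset {X : Set EllentuckSpace} (hX : RamseyLarge X) {A : Set ℕ}
    (hA : A.Infinite) : ∃ S ∈ X, S.1 ⊆ A := by
  have hX' : X ∈ residual EllentuckSpace := by simpa [RamseyLarge, IsMeagre] using hX
  obtain ⟨S, ⟨-, hSA⟩, hSX⟩ := (dense_of_mem_residual hX').inter_open_nonempty _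
    (EllentuckSpace.isOpen_between ∅ ⟨A, hA⟩ (by simp)) ⟨⟨A, hA⟩, by simp, subset_rfl⟩
  exact ⟨S, hSX, hSA⟩

/-! ### Tapes -/

namespace Turing

/-- The opposite direction. -/
def Dir.flip : Dir → Dir
  | Dir.left => Dir.right
  | Dir.right => Dir.left

/-- The displacement of a head moving in the given direction. -/
def Dir.sign : Dir → ℤ
  | Dir.left => -1
  | Dir.right => 1

instance : Finite Dir :=
  Finite.of_surjective (fun b : Bool => cond b Dir.left Dir.right) fun d => by
    cases d
    exacts [⟨true, rfl⟩, ⟨false, rfl⟩]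

theorem Tape.move_nth {Γ : Type} [Inhabited Γ] (T : Tape Γ) (d : Dir) (i : ℤ) :
    (T.move d).nth i = T.nth (i + d.sign) := by
  cases d <;> simp [Dir.sign, sub_eq_add_neg]

theorem Tape.mk₁_nth_nat {Γ : Type} [Inhabited Γ] (l : List Γ) (n : ℕ) :
    (Tape.mk₁ l).nth n = l.getI n := by
  simp [Tape.mk₁, Tape.mk₂]

theorem Tape.mk₁_nth_neg {Γ : Type} [Inhabited Γ] (l : List Γ) {i : ℤ} (hi : i < 0) :
    (Tape.mk₁ l).nth i = default := by
  obtain ⟨n, rfl⟩ := Int.eq_negSucc_of_lt_zero hi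
  change (ListBlank.mk []).nth n = default
  simp [List.getI]

theorem Tape.move_right_mk₂ {Γ : Type} [Inhabited Γ] (a : Γ) (L R : List Γ) :
    (Tape.mk₂ L (a :: R)).move Dir.right = Tape.mk₂ (a :: L) R := by
  rw [Tape.mk₂, Tape.move_right_mk']
  rfl

/-- The tape whose head is on the blank just before the word `l`. -/
def Tape.before {Γ : Type} [Inhabited Γ] (l : List Γ) : Tape Γ :=
  (Tape.mk₁ l).move Dir.left

theorem Tape.before_nil {Γ : Type} [Inhabited Γ] :
    Tape.before ([] : List Γ) = Tape.mk₁ [] := by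
  rw [Tape.before, Tape.mk₁, Tape.mk₂, Tape.move_left_mk', ListBlank.head_mk, ListBlank.tail_mk]
  congr 1
  exact ListBlank.cons_head_tail (ListBlank.mk [])

theorem Tape.write_before {Γ : Type} [Inhabited Γ] (l : List Γ) (a : Γ) :
    (Tape.before l).write a = Tape.mk₁ (a :: l) := by
  rw [Tape.before, Tape.mk₁, Tape.mk₂, Tape.move_left_mk', Tape.write_mk', ListBlank.tail_cons]
  rfl

/-- Relative to the direction `d`, the nonblank cells of `T` are the `p` cells behind the head
and the `q` cells starting at the head. -/
def Tape.Marked {Γ : Type} [Inhabited Γ] (d : Dir) (p q : ℕ) (T : Tape Γ) : Prop :=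
  ∀ i : ℤ, T.nth i ≠ default ↔ -(p : ℤ) ≤ d.sign * i ∧ d.sign * i < q

namespace Tape.Marked

theorem head_ne_iff {Γ : Type} [Inhabited Γ] {d : Dir} {p q : ℕ} {T : Tape Γ}
    (h : T.Marked d p q) : T.head ≠ default ↔ q ≠ 0 := by
  rw [← Tape.nth_zero, h 0]
  simp [Nat.pos_iff_ne_zero]

theorem move {Γ : Type} [Inhabited Γ] {d : Dir} {p q : ℕ} {T : Tape Γ}
    (h : T.Marked d p (q + 1)) : (T.move d).Marked d (p + 1) q := by
  intro i
  rw [Tape.move_nth, h]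
  cases d <;> simp only [Dir.sign] <;> push_cast <;> constructor <;> intro h' <;> omega

theorem move_flip {Γ : Type} [Inhabited Γ] {d : Dir} {p : ℕ} {T : Tape Γ}
    (h : T.Marked d p 0) : (T.move d.flip).Marked d.flip 0 p := by
  intro i
  rw [Tape.move_nth, h]
  cases d <;> simp only [Dir.sign, Dir.flip] <;> push_cast <;> constructor <;> intro h' <;> omega

/-- The head is on the blank just past a block of `p` marks. Writing there lengthens the block, and
seen backwards the whole block lies ahead of the head. -/
theorem write_flip {Γ : Type} [Inhabited Γ] {d : Dir} {p : ℕ} {T : Tape Γ} {a : Γ}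
    (h : T.Marked d p 0) (ha : a ≠ default) : (T.write a).Marked d.flip 0 (p + 1) := by
  intro i
  rw [Tape.write_nth]
  split_ifs with hi
  · subst hi
    simp [ha]
  · rw [h]
    cases d <;> simp only [Dir.sign, Dir.flip] <;> push_cast <;> constructor <;> intro h' <;> omega

theorem write_move {Γ : Type} [Inhabited Γ] {d : Dir} {p : ℕ} {T : Tape Γ} {a : Γ}
    (h : T.Marked d p 0) (ha : a ≠ default) : ((T.write a).move d).Marked d (p + 1) 0 := by
  intro i
  rw [Tape.move_nth, Tape.write_nth]
  split_ifs with hi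
  · cases d <;> simp only [Dir.sign] at * <;> push_cast <;>
      refine iff_of_true ha ?_ <;> omega
  · rw [h]
    cases d <;> simp only [Dir.sign] at * <;> push_cast <;> constructor <;> intro h' <;> omega

theorem mk₁_nil {Γ : Type} [Inhabited Γ] (d : Dir) : (Tape.mk₁ ([] : List Γ)).Marked d 0 0 := by
  intro i
  have : (Tape.mk₁ ([] : List Γ)).nth i = default := by
    rcases lt_or_ge i 0 with hi | hi
    · exact Tape.mk₁_nth_neg _ hi
    · obtain ⟨n, rfl⟩ := Int.eq_ofNat_of_zero_le hi
      rw [Tape.mk₁_nth_nat]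
      rfl
  simp only [this]
  simp

end Tape.Marked

/-- The head of `T` and the cells to its left, `r` cells in all, are not blank. -/
def Tape.ClockAtLeast {Γ : Type} [Inhabited Γ] (r : ℕ) (T : Tape Γ) : Prop :=
  ∀ j : ℕ, j < r → T.nth (-j) ≠ default

namespace Tape.ClockAtLeast

theorem mono {Γ : Type} [Inhabited Γ] {r s : ℕ} {T : Tape Γ} (h : T.ClockAtLeast r)
    (hs : s ≤ r) : T.ClockAtLeast s :=
  fun j hj => h j (hj.trans_le hs)

theorem head_ne {Γ : Type} [Inhabited Γ] {r : ℕ} {T : Tape Γ} (h : T.ClockAtLeast (r + 1)) :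
    T.head ≠ default := by
  simpa using h 0 r.succ_pos

theorem move_left {Γ : Type} [Inhabited Γ] {r : ℕ} {T : Tape Γ} (h : T.ClockAtLeast (r + 1)) :
    (T.move Dir.left).ClockAtLeast r := by
  intro j hj
  rw [Tape.move_left_nth]
  convert h (j + 1) (by omega) using 2
  push_cast
  ring

theorem move_left_iterate {Γ : Type} [Inhabited Γ] {r s : ℕ} {T : Tape Γ}
    (h : T.ClockAtLeast (r + s)) : ((Tape.move Dir.left)^[s] T).ClockAtLeast r := by
  induction s generalizing T with
  | zero => exact h
  | succ s ih => exact ih (move_left h)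

end Tape.ClockAtLeast

end Turing

/-! ### Runs of oracle machines -/

namespace OracleTM

open Turing (Dir)

@[simp]
theorem actTape_head_none {Γ : Type} [Inhabited Γ] (T : Turing.Tape Γ) :
    actTape T T.head none = T :=
  Turing.Tape.write_self T

@[simp]
theorem actTape_head_some {Γ : Type} [Inhabited Γ] (T : Turing.Tape Γ) (d : Dir) :
    actTape T T.head (some d) = T.move d := by
  simp [actTape]

theorem actTape_before {Γ : Type} [Inhabited Γ] (l : List Γ) (a : Γ) :
    actTape (Turing.Tape.before l) a (some Dir.left) = Turing.Tape.before (a :: l) := by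
  simp only [actTape, Turing.Tape.write_before]
  rfl

/-- The answer is a Boolean given by an equivalence, which keeps decidability instances out of later
statements. -/
theorem succs_of_ask {M : OracleTM} {A : Language Bool} {c : M.Cfg} {f : Bool → M.State}
    {b : Bool} (h : M.ask c.state = some f) (hb : b = true ↔ c.query ∈ A) :
    M.succs A c = {⟨f b, c.tape, []⟩} := by
  classical
  have : b = decide (c.query ∈ A) := by
    rw [Bool.eq_iff_iff, hb, decide_eq_true_iff]
  subst this
  simp only [succs, h]

theorem succs_of_not_ask {M : OracleTM} (A : Language Bool) {c : M.Cfg}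
    (h : M.ask c.state = none) :
    M.succs A c = M.act c '' M.trans c.state (fun i => (c.tape i).head) := by
  simp only [succs, h]

/-- Some computation starting in `c` halts in an accepting state. -/
def AcceptsFrom (M : OracleTM) (A : Language Bool) (c : M.Cfg) : Prop :=
  ∃ n c', M.ReachIn A n c c' ∧ M.succs A c' = ∅ ∧ c'.state ∈ M.accept

/-- Every computation starting in `c` halts after at most `t` steps. -/
def HaltsFrom (M : OracleTM) (A : Language Bool) (c : M.Cfg) (t : ℕ) : Prop :=
  ∀ n c', M.ReachIn A n c c' → n ≤ t

theorem acceptsFrom_iff {M : OracleTM} {A : Language Bool} {c : M.Cfg} :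
    M.AcceptsFrom A c ↔
      (M.succs A c = ∅ ∧ c.state ∈ M.accept) ∨ ∃ d ∈ M.succs A c, M.AcceptsFrom A d := by
  constructor
  · rintro ⟨n, c', hr, hc'⟩
    cases n with
    | zero =>
      obtain rfl : c = c' := hr
      exact Or.inl hc'
    | succ n =>
      obtain ⟨d, hd, hr⟩ := hr
      exact Or.inr ⟨d, hd, n, c', hr, hc'⟩
  · rintro (h | ⟨d, hd, n, c', hr, hc'⟩)
    · exact ⟨0, c, rfl, h⟩
    · exact ⟨n + 1, c', ⟨d, hd, hr⟩, hc'⟩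

theorem HaltsFrom.succs_eq_empty {M : OracleTM} {A : Language Bool} {c : M.Cfg}
    (h : M.HaltsFrom A c 0) : M.succs A c = ∅ := by
  refine Set.eq_empty_of_forall_notMem fun d hd => ?_
  exact absurd (h 1 d ⟨d, hd, rfl⟩) (by norm_num)

theorem haltsFrom_succ {M : OracleTM} {A : Language Bool} {c : M.Cfg} {t : ℕ} :
    M.HaltsFrom A c (t + 1) ↔ ∀ d ∈ M.succs A c, M.HaltsFrom A d t := by
  constructor
  · exact fun h d hd n c' hr => Nat.le_of_succ_le_succ (h (n + 1) c' ⟨d, hd, hr⟩)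
  · intro h n c' hr
    cases n with
    | zero => exact Nat.zero_le _
    | succ n =>
      obtain ⟨d, hd, hr⟩ := hr
      exact Nat.succ_le_succ (h d hd n c' hr)

theorem HaltsFrom.mono {M : OracleTM} {A : Language Bool} {c : M.Cfg} {s t : ℕ}
    (h : M.HaltsFrom A c s) (hst : s ≤ t) : M.HaltsFrom A c t :=
  fun n c' hr => (h n c' hr).trans hst

/-- A bound on the running time from a decreasing family of invariants. -/
theorem haltsFrom_of_invariant {M : OracleTM} {A : Language Bool} (I : ℕ → M.Cfg → Prop)
    (hI : ∀ r c, I r c → ∀ d ∈ M.succs A c, ∃ s < r, I s d) {r : ℕ} {c : M.Cfg} (h : I r c) :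
    M.HaltsFrom A c r := by
  intro n
  induction n generalizing r c with
  | zero => exact fun _ _ => Nat.zero_le _
  | succ n ih =>
    rintro c' ⟨d, hd, hr⟩
    obtain ⟨s, hs, hsd⟩ := hI r c h d hd
    exact (ih hsd c' hr).trans_lt hs

/-- From `c` the machine has a unique computation of length `n`, which leads to `c'`. -/
def DetReach (M : OracleTM) (A : Language Bool) : ℕ → M.Cfg → M.Cfg → Prop
  | 0, c, c' => c = c'
  | n + 1, c, c' => ∃ d, M.succs A c = {d} ∧ M.DetReach A n d c'

namespace DetReach

theorem single {M : OracleTM} {A : Language Bool} {c d : M.Cfg} (h : M.succs A c = {d}) :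
    M.DetReach A 1 c d :=
  ⟨d, h, rfl⟩

theorem congr {M : OracleTM} {A : Language Bool} {m n : ℕ} {c c' d d' : M.Cfg}
    (h : M.DetReach A m c d) (hn : m = n) (hc : c = c') (hd : d = d') :
    M.DetReach A n c' d' := by
  subst hn hc hd
  exact h

theorem trans {M : OracleTM} {A : Language Bool} {m n : ℕ} {c d e : M.Cfg}
    (h₁ : M.DetReach A m c d) (h₂ : M.DetReach A n d e) : M.DetReach A (m + n) c e := by
  induction m generalizing c with
  | zero =>
    obtain rfl : c = d := h₁
    rwa [Nat.zero_add]
  | succ m ih =>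
    obtain ⟨c', hc', h⟩ := h₁
    rw [Nat.succ_add]
    exact ⟨c', hc', ih h⟩

theorem head {M : OracleTM} {A : Language Bool} {n : ℕ} {c d e : M.Cfg}
    (h₁ : M.succs A c = {d}) (h₂ : M.DetReach A n d e) : M.DetReach A (n + 1) c e :=
  ⟨d, h₁, h₂⟩

/-- No configuration strictly before `d` on the path halts, and none branches, so every halting
computation from `c` passes through `d`. -/
theorem acceptsFrom_iff {M : OracleTM} {A : Language Bool} {n : ℕ} {c d : M.Cfg}
    (h : M.DetReach A n c d) : M.AcceptsFrom A c ↔ M.AcceptsFrom A d := by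
  induction n generalizing c with
  | zero =>
    obtain rfl : c = d := h
    rfl
  | succ n ih =>
    obtain ⟨c', hc', h⟩ := h
    rw [OracleTM.acceptsFrom_iff, hc', ← ih h]
    simp

theorem haltsFrom {M : OracleTM} {A : Language Bool} {n t : ℕ} {c d : M.Cfg}
    (h : M.DetReach A n c d) (hd : M.HaltsFrom A d t) : M.HaltsFrom A c (n + t) := by
  induction n generalizing c with
  | zero =>
    obtain rfl : c = d := h
    rwa [Nat.zero_add]
  | succ n ih =>
    obtain ⟨c', hc', h⟩ := h
    rw [Nat.succ_add, haltsFrom_succ, hc']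
    rintro _ rfl
    exact ih h

end DetReach

end OracleTM

/-! ### Replacing a tally oracle by a table that is part of the input -/

namespace OracleTM

open Turing (Dir)

/-- The states of the machine that simulates a machine with states `Q` and reads the answers of
the oracle from a table. -/
inductive TableState (Q : Type)
  | read
  | readBit (tag : Bool)
  | sim (q : Q) (bad : Bool)
  | back (q : Q)
  | dead

instance {Q : Type} [Finite Q] : Finite (TableState Q) := by
  let f : (Option (Option Bool)) ⊕ ((Q × Bool) ⊕ Q) → TableState Q :=
    Sum.elim (fun o => match o with
      | none => .read
      | some none => .dead
      | some (some b) => .readBit b) (Sum.elim (fun p => .sim p.1 p.2) .back)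
  refine Finite.of_surjective f fun s => ?_
  cases s with
  | read => exact ⟨.inl none, rfl⟩
  | readBit b => exact ⟨.inl (some (some b)), rfl⟩
  | sim q b => exact ⟨.inr (.inl (q, b)), rfl⟩
  | back q => exact ⟨.inr (.inr q), rfl⟩
  | dead => exact ⟨.inl (some none), rfl⟩

/-- The movement of the heads on the clock tape and on the table tape. -/
def sideMove (clock table : Option Dir) : Bool → Option Dir
  | false => clock
  | true => table

open Classical in
/-- The actions of the table machine.  Tape `inr false` holds the input and serves as a clock once
the input has been read, tape `inr true` holds the table. -/
noncomputable def tableTrans (N : OracleTM) :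
    TableState N.State → (N.Tape ⊕ Bool → N.Symbol) →
      Set (TMAction (TableState N.State) N.Symbol (N.Tape ⊕ Bool))
  | .read, s =>
    -- A blank ends the input: the clock head steps back onto the last letter, and the heads of the
    -- two freshly written tapes step onto their first cells.
    if s (.inr false) = default then
      {{ next := .sim N.start false
         write := s
         move := Sum.elim (fun i => if i = N.inputTape then some Dir.right else none)
          (sideMove (some Dir.left) (some Dir.right))
         emit := none }}
    else
      {{ next := .readBit (decide (s (.inr false) = N.bit true))
         write := s
         move := Sum.elim (fun _ => none) (sideMove (some Dir.right) none)
         emit := none }}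
  | .readBit true, s =>
    -- A blank instead of the second letter of a pair: the input has odd length and is rejected.
    if s (.inr false) = default then
      {{ next := .dead, write := s, move := fun _ => none, emit := none }}
    else
      {{ next := .read
         write := Sum.elim (fun i => s (.inl i)) (fun _ => s (.inr false))
         move := Sum.elim (fun _ => none) (sideMove (some Dir.right) (some Dir.left))
         emit := none }}
  | .readBit false, s =>
    if s (.inr false) = default then
      {{ next := .dead, write := s, move := fun _ => none, emit := none }}
    else
      {{ next := .read
         write := Sum.elim (fun i => if i = N.inputTape then s (.inr false) else s (.inl i))
          (fun b => s (.inr b))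
         move := Sum.elim (fun i => if i = N.inputTape then some Dir.left else none)
          (sideMove (some Dir.right) none)
         emit := none }}
  | .sim q bad, s =>
    if s (.inr false) = default then
      {{ next := .dead, write := s, move := fun _ => none, emit := none }}
    else match N.ask q with
      | some f =>
        -- The table head has moved once for each letter `0` of the query, and `bad` records whether
        -- a letter `1` occurred, in which case a tally oracle answers no.
        {{ next := .back (f (decide (bad = false ∧ s (.inr true) = N.bit true)))
           write := s
           move := Sum.elim (fun _ => none) (sideMove (some Dir.left) none)
           emit := none }}
      | none =>
        (fun a =>
          { next := .sim a.next (bad || decide (a.emit = some true))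
            write := Sum.elim a.write (fun b => s (.inr b))
            move := Sum.elim a.move
              (sideMove (some Dir.left) (if a.emit = some false then some Dir.right else none))
            emit := none }) '' N.trans q (fun i => s (.inl i))
  | .back q, s =>
    if s (.inr false) = default then
      {{ next := .dead, write := s, move := fun _ => none, emit := none }}
    -- The query is now empty, so the table head returns to cell `0`, recognised by the blank before
    -- it.
    else if s (.inr true) = default then
      {{ next := .sim q false
         write := s
         move := Sum.elim (fun _ => none) (sideMove (some Dir.left) (some Dir.right))
         emit := none }}
    else
      {{ next := .back q
         write := s
         move := Sum.elim (fun _ => none) (sideMove (some Dir.left) (some Dir.left))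
         emit := none }}
  | .dead, _ => ∅

/-- The oracle-free machine that, given a word together with a table of the answers of a tally
oracle, simulates `N` on this word until the time given by the length of the input is over. -/
noncomputable def tableMachine (N : OracleTM) : OracleTM where
  State := TableState N.State
  Symbol := N.Symbol
  Tape := N.Tape ⊕ Bool
  finState := haveI := N.finState; inferInstance
  finSymbol := N.finSymbol
  finTape := haveI := N.finTape; inferInstance
  blank := N.blank
  bit := N.bit
  bit_injective := N.bit_injective
  bit_ne_blank := N.bit_ne_blank
  inputTape := .inr false
  start := .read
  accept := {s | ∃ q bad, s = .sim q bad ∧ q ∈ N.accept}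
  ask := fun _ => none
  trans := tableTrans N

theorem tableMachine_oracleFree (N : OracleTM) : N.tableMachine.OracleFree :=
  fun _ => rfl

/-- A configuration of the table machine. -/
def tableCfg (N : OracleTM) (q : TableState N.State) (tape : N.Tape → Turing.Tape N.Symbol)
    (clock table : Turing.Tape N.Symbol) : N.tableMachine.Cfg where
  state := q
  tape := Sum.elim tape (fun b => cond b table clock)
  query := []

theorem tableCfg_congr {N : OracleTM} {q q' : TableState N.State}
    {tape tape' : N.Tape → Turing.Tape N.Symbol} {clock clock' table table' : Turing.Tape N.Symbol}
    (hq : q = q') (ht : ∀ i, tape i = tape' i) (hc : clock = clock') (htb : table = table') :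
    tableCfg N q tape clock table = tableCfg N q' tape' clock' table' := by
  obtain rfl : tape = tape' := funext ht
  subst hq hc htb
  rfl

/-- The configuration resulting from an action of the table machine. -/
def tableAct (N : OracleTM) (tape : N.Tape → Turing.Tape N.Symbol)
    (clock table : Turing.Tape N.Symbol)
    (a : TMAction (TableState N.State) N.Symbol (N.Tape ⊕ Bool)) : N.tableMachine.Cfg :=
  { tableCfg N a.next (fun i => actTape (tape i) (a.write (.inl i)) (a.move (.inl i)))
      (actTape clock (a.write (.inr false)) (a.move (.inr false)))
      (actTape table (a.write (.inr true)) (a.move (.inr true))) with query := a.emit.toList }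

theorem tableAct_mk (N : OracleTM) (q : TableState N.State)
    (tape : N.Tape → Turing.Tape N.Symbol) (clock table : Turing.Tape N.Symbol)
    (w : N.Tape ⊕ Bool → N.Symbol) (m : N.Tape ⊕ Bool → Option Dir) :
    tableAct N tape clock table { next := q, write := w, move := m, emit := none } =
      tableCfg N q (fun i => actTape (tape i) (w (.inl i)) (m (.inl i)))
        (actTape clock (w (.inr false)) (m (.inr false)))
        (actTape table (w (.inr true)) (m (.inr true))) :=
  rfl

theorem act_tableCfg (N : OracleTM) (q : TableState N.State)
    (tape : N.Tape → Turing.Tape N.Symbol) (clock table : Turing.Tape N.Symbol) :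
    N.tableMachine.act (tableCfg N q tape clock table) = tableAct N tape clock table := by
  funext a
  simp only [act, tableCfg, tableAct]
  congr 1
  funext i
  rcases i with i | (_ | _) <;> rfl

theorem succs_tableCfg (N : OracleTM) (A : Language Bool) (q : TableState N.State)
    (tape : N.Tape → Turing.Tape N.Symbol) (clock table : Turing.Tape N.Symbol) :
    N.tableMachine.succs A (tableCfg N q tape clock table) =
      tableAct N tape clock table ''
        tableTrans N q (Sum.elim (fun i => (tape i).head)
          (fun b => cond b table.head clock.head)) := by
  rw [succs_of_not_ask A rfl, act_tableCfg]
  congr 2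
  funext i
  rcases i with i | (_ | _) <;> rfl

/-! ### Transitions of the table machine. -/

section Steps

variable (N : OracleTM) (A : Language Bool) (tape : N.Tape → Turing.Tape N.Symbol)
  (clock table : Turing.Tape N.Symbol)

open Classical in
theorem succs_read_blank (h : clock.head = default) :
    N.tableMachine.succs A (tableCfg N .read tape clock table) =
      {tableCfg N (.sim N.start false)
        (fun i => if i = N.inputTape then (tape i).move Dir.right else tape i)
        (clock.move Dir.left) (table.move Dir.right)} := by
  rw [succs_tableCfg]
  simp only [tableTrans, Sum.elim_inr, Sum.elim_inl, cond_false, cond_true, h, if_true,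
    Set.image_singleton, tableAct_mk]
  refine congrArg _ (tableCfg_congr rfl (fun i => ?_) ?_ ?_)
  · by_cases hi : i = N.inputTape <;> simp [hi]
  · rw [← h]; simp [sideMove]
  · simp [sideMove]

open Classical in
theorem succs_read_ne_blank (h : clock.head ≠ default) :
    N.tableMachine.succs A (tableCfg N .read tape clock table) =
      {tableCfg N (.readBit (decide (clock.head = N.bit true))) tape (clock.move Dir.right)
        table} := by
  rw [succs_tableCfg]
  simp only [tableTrans, Sum.elim_inr, Sum.elim_inl, cond_false, cond_true, h, if_false,
    Set.image_singleton, tableAct_mk]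
  refine congrArg _ (tableCfg_congr rfl (fun i => ?_) ?_ ?_) <;> simp [sideMove]

theorem succs_read (b : Bool) (h : clock.head = N.bit b) :
    N.tableMachine.succs A (tableCfg N .read tape clock table) =
      {tableCfg N (.readBit b) tape (clock.move Dir.right) table} := by
  rw [succs_read_ne_blank N A tape clock table (h ▸ N.bit_ne_blank b), h]
  simp [N.bit_injective.eq_iff]

theorem succs_readBit_true (h : clock.head ≠ default) :
    N.tableMachine.succs A (tableCfg N (.readBit true) tape clock table) =
      {tableCfg N .read tape (clock.move Dir.right)
        (actTape table clock.head (some Dir.left))} := by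
  rw [succs_tableCfg]
  simp only [tableTrans, Sum.elim_inr, Sum.elim_inl, cond_false, h, if_false,
    Set.image_singleton, tableAct_mk]
  refine congrArg _ (tableCfg_congr rfl (fun i => ?_) ?_ ?_) <;> simp [sideMove]

open Classical in
theorem succs_readBit_false (h : clock.head ≠ default) :
    N.tableMachine.succs A (tableCfg N (.readBit false) tape clock table) =
      {tableCfg N .read
        (fun i => if i = N.inputTape then actTape (tape i) clock.head (some Dir.left) else tape i)
        (clock.move Dir.right) table} := by
  rw [succs_tableCfg]
  simp only [tableTrans, Sum.elim_inr, Sum.elim_inl, cond_false, cond_true, h, if_false,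
    Set.image_singleton, tableAct_mk]
  refine congrArg _ (tableCfg_congr rfl (fun i => ?_) ?_ ?_)
  · by_cases hi : i = N.inputTape <;> simp [hi]
  · simp [sideMove]
  · simp [sideMove]

theorem succs_readBit_blank (b : Bool) (h : clock.head = default) :
    N.tableMachine.succs A (tableCfg N (.readBit b) tape clock table) =
      {tableCfg N .dead tape clock table} := by
  rw [succs_tableCfg]
  cases b <;>
  · simp only [tableTrans, Sum.elim_inr, Sum.elim_inl, cond_false, cond_true, h, if_true,
      Set.image_singleton, tableAct_mk]
    refine congrArg _ (tableCfg_congr rfl (fun i => ?_) ?_ ?_)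
    · simp
    · rw [← h]; simp
    · simp

theorem succs_sim_blank (q : N.State) (b : Bool) (h : clock.head = default) :
    N.tableMachine.succs A (tableCfg N (.sim q b) tape clock table) =
      {tableCfg N .dead tape clock table} := by
  rw [succs_tableCfg]
  simp only [tableTrans, Sum.elim_inr, Sum.elim_inl, cond_false, cond_true, h, if_true,
    Set.image_singleton, tableAct_mk]
  refine congrArg _ (tableCfg_congr rfl (fun i => ?_) ?_ ?_)
  · simp
  · rw [← h]; simp
  · simp

theorem succs_back_blank (q : N.State) (h : clock.head = default) :
    N.tableMachine.succs A (tableCfg N (.back q) tape clock table) =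
      {tableCfg N .dead tape clock table} := by
  rw [succs_tableCfg]
  simp only [tableTrans, Sum.elim_inr, Sum.elim_inl, cond_false, cond_true, h, if_true,
    Set.image_singleton, tableAct_mk]
  refine congrArg _ (tableCfg_congr rfl (fun i => ?_) ?_ ?_)
  · simp
  · rw [← h]; simp
  · simp

theorem succs_dead :
    N.tableMachine.succs A (tableCfg N .dead tape clock table) = ∅ := by
  rw [succs_tableCfg]
  simp [tableTrans]

open Classical in
theorem succs_sim_ask (q : N.State) (bad : Bool) (f : Bool → N.State) (hq : N.ask q = some f)
    (h : clock.head ≠ default) :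
    N.tableMachine.succs A (tableCfg N (.sim q bad) tape clock table) =
      {tableCfg N (.back (f (decide (bad = false ∧ table.head = N.bit true)))) tape
        (clock.move Dir.left) table} := by
  rw [succs_tableCfg]
  simp only [tableTrans, Sum.elim_inr, Sum.elim_inl, cond_false, cond_true, h, if_false, hq,
    Set.image_singleton, tableAct_mk]
  refine congrArg _ (tableCfg_congr rfl (fun i => ?_) ?_ ?_) <;> simp [sideMove]

open Classical in
theorem succs_sim (q : N.State) (bad : Bool) (hq : N.ask q = none) (h : clock.head ≠ default) :
    N.tableMachine.succs A (tableCfg N (.sim q bad) tape clock table) =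
      (fun a => tableCfg N (.sim a.next (bad || decide (a.emit = some true)))
        (fun i => actTape (tape i) (a.write i) (a.move i)) (clock.move Dir.left)
        (if a.emit = some false then table.move Dir.right else table)) ''
          N.trans q (fun i => (tape i).head) := by
  rw [succs_tableCfg]
  simp only [tableTrans, Sum.elim_inr, Sum.elim_inl, cond_false, h, if_false, hq]
  rw [Set.image_image]
  refine Set.image_congr fun a _ => ?_
  rw [tableAct_mk]
  refine tableCfg_congr rfl (fun i => rfl) ?_ ?_
  · simp [sideMove]
  · by_cases ha : a.emit = some false <;> simp [sideMove, ha]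

theorem succs_back_of_blank (q : N.State) (h : clock.head ≠ default) (ht : table.head = default) :
    N.tableMachine.succs A (tableCfg N (.back q) tape clock table) =
      {tableCfg N (.sim q false) tape (clock.move Dir.left) (table.move Dir.right)} := by
  rw [succs_tableCfg]
  simp only [tableTrans, Sum.elim_inr, Sum.elim_inl, cond_false, cond_true, h, if_false, ht,
    if_true, Set.image_singleton, tableAct_mk]
  refine congrArg _ (tableCfg_congr rfl (fun i => ?_) ?_ ?_)
  · simp
  · simp [sideMove]
  · rw [← ht]; simp [sideMove]

theorem succs_back_of_ne_blank (q : N.State) (h : clock.head ≠ default)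
    (ht : table.head ≠ default) :
    N.tableMachine.succs A (tableCfg N (.back q) tape clock table) =
      {tableCfg N (.back q) tape (clock.move Dir.left) (table.move Dir.left)} := by
  rw [succs_tableCfg]
  simp only [tableTrans, Sum.elim_inr, Sum.elim_inl, cond_false, cond_true, h, if_false, ht,
    Set.image_singleton, tableAct_mk]
  refine congrArg _ (tableCfg_congr rfl (fun i => ?_) ?_ ?_) <;> simp [sideMove]

end Steps

end OracleTM

/-! ### Correctness and running time of the table machine. -/

namespace OracleTM

open Turing (Dir)

/-- The word that codes the word `x` and the table `t`. -/
def tableWord (x t : List Bool) : List Bool :=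
  t.reverse.flatMap (fun b => [true, b]) ++ x.reverse.flatMap (fun b => [false, b])

theorem length_tableWord (x t : List Bool) :
    (tableWord x t).length = 2 * t.length + 2 * x.length := by
  simp [tableWord, mul_comm]

/-! #### Reading the input -/

theorem init_tableMachine (N : OracleTM) (w : List Bool) :
    N.tableMachine.init w =
      tableCfg N .read (fun _ => Turing.Tape.mk₁ []) (Turing.Tape.mk₁ (w.map N.bit))
        (Turing.Tape.mk₁ []) := by
  simp only [init, tableCfg]
  congr 1
  funext i
  rcases i with i | (_ | _)
  · exact if_neg (by rintro ⟨⟩)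
  · exact if_pos rfl
  · exact if_neg (by rintro ⟨⟩)

/-- A pair takes two steps and pushes its letter onto the front of the table tape, so the pairs come
out reversed; this is why `tableWord` lists the table backwards. The accumulators `t` and `L` make
the induction go through. -/
theorem detReach_read_table (N : OracleTM) (A : Language Bool)
    (tape : N.Tape → Turing.Tape N.Symbol) (w u t : List Bool) (L : List N.Symbol) :
    N.tableMachine.DetReach A (2 * u.length)
      (tableCfg N .read tape
        (Turing.Tape.mk₂ L ((u.flatMap (fun b => [true, b]) ++ w).map N.bit))
        (Turing.Tape.before (t.map N.bit)))
      (tableCfg N .read tape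
        (Turing.Tape.mk₂ (((u.flatMap fun b => [true, b]).map N.bit).reverse ++ L)
          (w.map N.bit))
        (Turing.Tape.before ((u.reverse ++ t).map N.bit))) := by
  induction u generalizing t L with
  | nil => rfl
  | cons b u ih =>
    have h := ih (b :: t) (N.bit b :: N.bit true :: L)
    refine .head (succs_read N A _ _ _ true rfl) (.head (succs_readBit_true N A _ _ _ ?_) ?_)
    · exact N.bit_ne_blank b
    · refine h.congr rfl (tableCfg_congr rfl (fun _ => rfl) ?_ ?_)
        (tableCfg_congr rfl (fun _ => rfl) ?_ ?_)
      · simp only [List.flatMap_cons, List.cons_append, List.nil_append, List.map_cons,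
          Turing.Tape.move_right_mk₂]
      · exact (actTape_before _ _).symm
      · simp
      · simp

/-- The tapes with the word `x` to the right of the head on the input tape. -/
noncomputable def inputBefore (N : OracleTM) (x : List Bool) : N.Tape → Turing.Tape N.Symbol :=
  open Classical in
  fun i => if i = N.inputTape then Turing.Tape.before (x.map N.bit) else Turing.Tape.mk₁ []

theorem inputBefore_nil (N : OracleTM) (i : N.Tape) :
    inputBefore N [] i = Turing.Tape.mk₁ [] := by
  by_cases hi : i = N.inputTape <;> simp [inputBefore, hi, Turing.Tape.before_nil]

theorem detReach_read_input (N : OracleTM) (A : Language Bool)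
    (table : Turing.Tape N.Symbol) (w u x : List Bool) (L : List N.Symbol) :
    N.tableMachine.DetReach A (2 * u.length)
      (tableCfg N .read (inputBefore N x)
        (Turing.Tape.mk₂ L ((u.flatMap (fun b => [false, b]) ++ w).map N.bit)) table)
      (tableCfg N .read (inputBefore N (u.reverse ++ x))
        (Turing.Tape.mk₂ (((u.flatMap fun b => [false, b]).map N.bit).reverse ++ L)
          (w.map N.bit)) table) := by
  induction u generalizing x L with
  | nil => rfl
  | cons b u ih =>
    have h := ih (b :: x) (N.bit b :: N.bit false :: L)
    refine .head (succs_read N A _ _ _ false rfl) (.head (succs_readBit_false N A _ _ _ ?_) ?_)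
    · exact N.bit_ne_blank b
    · refine h.congr rfl (tableCfg_congr rfl (fun i => ?_) ?_ rfl)
        (tableCfg_congr rfl (fun i => ?_) ?_ rfl)
      · by_cases hi : i = N.inputTape
        · simp only [inputBefore, hi, if_true]
          exact (actTape_before _ _).symm
        · simp [inputBefore, hi]
      · simp only [List.flatMap_cons, List.cons_append, List.nil_append, List.map_cons,
          Turing.Tape.move_right_mk₂]
      · simp
      · simp

/-- After both blocks, one more step on the final blank puts the heads in place. The letters just
read all lie at or to the left of the clock head and become the clock. -/
theorem detReach_read (N : OracleTM) (A : Language Bool) (x t : List Bool) :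
    ∃ clock : Turing.Tape N.Symbol, clock.ClockAtLeast (tableWord x t).length ∧
      N.tableMachine.DetReach A ((tableWord x t).length + 1)
        (N.tableMachine.init (tableWord x t))
        (tableCfg N (.sim N.start false) (N.init x).tape clock
          (Turing.Tape.mk₁ (t.map N.bit))) := by
  have h₁ := detReach_read_table N A (inputBefore N [])
    (x.reverse.flatMap fun b => [false, b]) t.reverse [] []
  have h₂ := detReach_read_input N A (Turing.Tape.before (t.map N.bit)) [] x.reverse []
    (((t.reverse.flatMap fun b => [true, b]).map N.bit).reverse ++ [])
  simp only [List.append_nil, List.reverse_reverse] at h₁ h₂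
  have h₃ := succs_read_blank N A (inputBefore N x)
    (Turing.Tape.mk₂ (((tableWord x t).map N.bit).reverse) ([] : List N.Symbol))
    (Turing.Tape.before (t.map N.bit)) rfl
  refine ⟨(Turing.Tape.mk₂ ((tableWord x t).map N.bit).reverse []).move Dir.left, ?_, ?_⟩
  rotate_left
  · have h₄ := h₁.trans h₂
    rw [← List.reverse_append, ← List.map_append] at h₄
    refine (h₄.trans (.single h₃)).congr ?_ ?_ ?_
    · rw [length_tableWord]
      simp
    · rw [init_tableMachine]
      refine tableCfg_congr rfl (inputBefore_nil N) rfl ?_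
      simp [Turing.Tape.before_nil]
    · refine tableCfg_congr rfl (fun i => ?_) rfl ?_
      · by_cases hi : i = N.inputTape <;> simp [inputBefore, hi, init, Turing.Tape.before]
      · simp [Turing.Tape.before]
  · intro j hj
    have hj' : j < ((tableWord x t).map N.bit).reverse.length := by simpa using hj
    have h := List.getElem_mem hj'
    simp only [List.mem_reverse, List.mem_map] at h
    obtain ⟨b, -, hb⟩ := h
    rw [Turing.Tape.move_left_nth]
    have : (-(j : ℤ) - 1) = Int.negSucc j := by omega
    rw [this]
    change List.getI _ j ≠ default
    rw [List.getI_eq_getElem _ hj']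
    exact hb ▸ N.bit_ne_blank b

/-! #### The simulation -/

/-- A tally oracle contains only words of the form `0 ⋯ 0`. -/
def IsTally (A : Language Bool) : Prop :=
  ∀ w ∈ A, true ∉ w

/-- The configuration of the table machine that corresponds to a configuration of `N`. -/
noncomputable def liftCfg (N : OracleTM) (table clock : Turing.Tape N.Symbol) (c : N.Cfg) :
    N.tableMachine.Cfg :=
  tableCfg N (.sim c.state (decide (true ∈ c.query))) c.tape clock
    ((Turing.Tape.move Dir.right)^[c.query.count false] table)

/-- The first `n` cells of the tape contain the answers of the oracle `A`. -/
def IsTable (N : OracleTM) (A : Language Bool) (n : ℕ) (table : Turing.Tape N.Symbol) : Prop :=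
  table.nth (-1) = default ∧ ∀ i < n, ∃ b : Bool, table.nth i = N.bit b ∧
    (b = true ↔ List.replicate i false ∈ A)

/-- From cell `i` it takes `i + 1` moves to reach the blank at `-1` and one move back to cell `0`;
each uses up one cell of the clock. -/
theorem detReach_back (N : OracleTM) {A : Language Bool} {n : ℕ} {table : Turing.Tape N.Symbol}
    (htable : N.IsTable A n table) (B : Language Bool) (q : N.State)
    (tape : N.Tape → Turing.Tape N.Symbol) (i : ℕ) (hi : i < n) (clock : Turing.Tape N.Symbol)
    (hc : clock.ClockAtLeast (i + 2)) :
    N.tableMachine.DetReach B (i + 2)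
      (tableCfg N (.back q) tape clock ((Turing.Tape.move Dir.right)^[i] table))
      (tableCfg N (.sim q false) tape ((Turing.Tape.move Dir.left)^[i + 2] clock) table) := by
  have hne : ∀ j < n, ((Turing.Tape.move Dir.right)^[j] table).head ≠ default := by
    intro j hj
    obtain ⟨b, hb, -⟩ := htable.2 j hj
    rw [Turing.Tape.move_right_n_head, hb]
    exact N.bit_ne_blank b
  induction i generalizing clock with
  | zero =>
    refine .head (succs_back_of_ne_blank N B _ _ _ _ hc.head_ne (hne 0 hi))
      (.single ?_)
    rw [succs_back_of_blank N B _ _ _ _ hc.move_left.head_ne]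
    · simp
    · rw [← Turing.Tape.nth_zero, Turing.Tape.move_left_nth]
      exact htable.1
  | succ i ih =>
    refine .head (succs_back_of_ne_blank N B _ _ _ _ hc.head_ne (hne _ hi)) ?_
    rw [Function.iterate_succ_apply' _ i, Turing.Tape.move_right_left]
    exact ih (by omega) _ hc.move_left

theorem eq_replicate_of_notMem {w : List Bool} (h : true ∉ w) :
    w = List.replicate (w.count false) false := by
  have hw : ∀ b ∈ w, b = false := by
    rintro (_ | _) hb
    · rfl
    · exact absurd hb h
  have := List.eq_replicate_of_mem hw
  rw [this, List.count_replicate_self]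

/-- An emitted letter changes the flag or the position of the table head just as it changes the
presence of `true` and the number of `false` in the query. The oracle `B` is arbitrary since the
table machine never asks. -/
theorem succs_liftCfg (N : OracleTM) (A B : Language Bool) (table clock : Turing.Tape N.Symbol)
    (c : N.Cfg) (hq : N.ask c.state = none) (hc : clock.head ≠ default) :
    N.tableMachine.succs B (liftCfg N table clock c) =
      liftCfg N table (clock.move Dir.left) '' N.succs A c := by
  rw [succs_of_not_ask A hq, liftCfg, succs_sim N B _ _ _ _ _ hq hc, Set.image_image]
  refine Set.image_congr fun a _ => ?_
  refine tableCfg_congr ?_ (fun i => rfl) rfl ?_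
  · rcases ha : a.emit with _ | (_ | _) <;> simp [act, ha]
  · rcases ha : a.emit with _ | (_ | _) <;> simp [act, ha, Function.iterate_succ_apply']

/-- A query containing `true` is not in `A`; any other query is determined by its length, and the
table head stands on the cell with its answer. One step reads the answer, the others rewind the
table. -/
theorem detReach_liftCfg_ask (N : OracleTM) {A : Language Bool} (hA : IsTally A) {n : ℕ}
    {table : Turing.Tape N.Symbol} (htable : N.IsTable A n table) (B : Language Bool)
    (clock : Turing.Tape N.Symbol) (c d : N.Cfg) (f : Bool → N.State)
    (hq : N.ask c.state = some f) (hd : N.succs A c = {d}) (hn : c.query.length < n)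
    (hc : clock.ClockAtLeast (c.query.count false + 3)) :
    N.tableMachine.DetReach B (c.query.count false + 3) (liftCfg N table clock c)
      (liftCfg N table ((Turing.Tape.move Dir.left)^[c.query.count false + 3] clock) d) := by
  classical
  have hlt : c.query.count false < n := List.count_le_length.trans_lt hn
  obtain ⟨b, hb, hbA⟩ := htable.2 _ hlt
  have hanswer : (decide (true ∈ c.query) = false ∧
      ((Turing.Tape.move Dir.right)^[c.query.count false] table).head = N.bit true) ↔
      c.query ∈ A := by
    rw [Turing.Tape.move_right_n_head, hb, N.bit_injective.eq_iff, hbA, decide_eq_false_iff_not]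
    constructor
    · rintro ⟨h₁, h₂⟩
      rwa [eq_replicate_of_notMem h₁]
    · intro h
      refine ⟨hA _ h, ?_⟩
      rwa [← eq_replicate_of_notMem (hA _ h)]
  obtain ⟨b', hb', h₁⟩ : ∃ b' : Bool, (b' = true ↔ c.query ∈ A) ∧
      N.tableMachine.succs B (liftCfg N table clock c) =
        {tableCfg N (.back (f b')) c.tape (clock.move Dir.left)
          ((Turing.Tape.move Dir.right)^[c.query.count false] table)} :=
    ⟨_, by rwa [decide_eq_true_iff], succs_sim_ask N B _ _ _ _ _ f hq hc.head_ne⟩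
  rw [succs_of_ask hq hb', Set.singleton_eq_singleton_iff] at hd
  subst hd
  exact .head h₁ (detReach_back N htable B _ c.tape _ hlt _ hc.move_left)

/-- Amortised clock: an answered query costs at most its length plus `3`, and the length is paid for
as the letters are emitted. The final `+ 1` keeps the clock head off the blank in a halting
configuration, where the table machine would otherwise step to `dead`. The bound on the query length
plus `t` keeps all queries within the table. -/
theorem acceptsFrom_liftCfg_iff (N : OracleTM) {A : Language Bool} (hA : IsTally A) {n : ℕ}
    {table : Turing.Tape N.Symbol} (htable : N.IsTable A n table) (B : Language Bool) (t : ℕ) :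
    ∀ (c : N.Cfg) (clock : Turing.Tape N.Symbol), N.HaltsFrom A c t → c.query.length + t < n →
      clock.ClockAtLeast (4 * t + c.query.length + 1) →
      (N.tableMachine.AcceptsFrom B (liftCfg N table clock c) ↔ N.AcceptsFrom A c) := by
  have hstep : ∀ (c : N.Cfg) (clock : Turing.Tape N.Symbol), N.ask c.state = none →
      clock.head ≠ default →
      (∀ d ∈ N.succs A c, N.tableMachine.AcceptsFrom B
        (liftCfg N table (clock.move Dir.left) d) ↔ N.AcceptsFrom A d) →
      (N.tableMachine.AcceptsFrom B (liftCfg N table clock c) ↔ N.AcceptsFrom A c) := by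
    intro c clock hq hc ih
    rw [acceptsFrom_iff, acceptsFrom_iff, succs_liftCfg N A B table clock c hq hc,
      Set.image_eq_empty, Set.exists_mem_image]
    refine or_congr (and_congr_right fun _ => ?_) (exists_congr fun d => and_congr_right (ih d))
    constructor
    · rintro ⟨q, bad, h, hq⟩
      injection h with h
      exact h ▸ hq
    · exact fun h => ⟨_, _, rfl, h⟩
  induction t with
  | zero =>
    intro c clock hh hn hc
    have hempty := hh.succs_eq_empty
    cases hq : N.ask c.state with
    | none => exact hstep c clock hq hc.head_ne (by simp [hempty])
    -- A query state always has a successor, so it cannot be halting.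
    | some f => simp [succs, hq] at hempty
  | succ t ih =>
    intro c clock hh hn hc
    rw [haltsFrom_succ] at hh
    cases hq : N.ask c.state with
    | none =>
      refine hstep c clock hq hc.head_ne fun d hd => ?_
      have hlen : d.query.length ≤ c.query.length + 1 := by
        rw [succs_of_not_ask A hq] at hd
        obtain ⟨a, -, rfl⟩ := hd
        rcases ha : a.emit with _ | b <;> simp [act, ha]
      exact ih d _ (hh d hd) (by omega) (hc.mono (by omega) : Turing.Tape.ClockAtLeast
        (4 * t + d.query.length + 1 + 1) clock).move_left
    | some f =>
      classical
      have hd := succs_of_ask hq (b := decide (c.query ∈ A)) (by rw [decide_eq_true_iff])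
      have hcount : c.query.count false ≤ c.query.length := List.count_le_length
      have h := detReach_liftCfg_ask N hA htable B clock c _ f hq hd (by omega)
        (hc.mono (by omega))
      rw [h.acceptsFrom_iff, (DetReach.single hd).acceptsFrom_iff]
      refine ih _ _ (hh _ (by rw [hd]; rfl)) (by simp; omega)
        (Turing.Tape.ClockAtLeast.move_left_iterate (hc.mono ?_))
      simp
      omega

theorem isTable_mk₁ (N : OracleTM) (A : Language Bool) (t : List Bool)
    (ht : ∀ (i : ℕ) (hi : i < t.length), t[i] = true ↔ List.replicate i false ∈ A) :
    N.IsTable A t.length (Turing.Tape.mk₁ (t.map N.bit)) := by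
  refine ⟨Turing.Tape.mk₁_nth_neg _ (by norm_num), fun i hi => ⟨t[i], ?_, ht i hi⟩⟩
  rw [Turing.Tape.mk₁_nth_nat, List.getI_eq_getElem _ (by simpa using hi), List.getElem_map]

/-- With a sufficiently long table, the table machine accepts the same words as `N`. -/
theorem accepts_tableMachine_iff (N : OracleTM) {A : Language Bool} (hA : IsTally A)
    (B : Language Bool) (x t : List Bool) (s : ℕ) (hs : N.HaltsWithin A x s)
    (hlen : 2 * s + 1 ≤ t.length)
    (ht : ∀ (i : ℕ) (hi : i < t.length), t[i] = true ↔ List.replicate i false ∈ A) :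
    N.tableMachine.Accepts B (tableWord x t) ↔ N.Accepts A x := by
  obtain ⟨clock, hclock, hr⟩ := detReach_read N B x t
  refine hr.acceptsFrom_iff.trans
    (acceptsFrom_liftCfg_iff N hA (isTable_mk₁ N A t ht) B s (N.init x) clock hs ?_ ?_)
  · simp only [init, List.length_nil]
    omega
  -- The code has length at least `2 * t.length ≥ 4 * s + 2`, which covers the clock needed; this
  -- accounts for the factor `2` in `hlen`.
  · refine hclock.mono ?_
    rw [length_tableWord]
    simp only [init, List.length_nil]
    omega

/-! #### The running time -/

/-- The invariant that bounds the running time of the table machine: the states of the two phases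
of the computation, and the distances of the next blanks on the clock tape. -/
def TableInvariant (N : OracleTM) (r : ℕ) (c : N.tableMachine.Cfg) : Prop :=
  ∃ q tape clock table, c = tableCfg N q tape clock table ∧
    match q with
    | .read | .readBit _ => ∃ k l : ℕ, clock.nth k = default ∧
        clock.nth (-(l + 1 : ℕ)) = default ∧ r = 2 * k + l + 2
    | .sim _ _ | .back _ => ∃ l : ℕ, clock.nth (-l) = default ∧ r = l + 1
    | .dead => r = 0

/-- While reading, a step to the right lowers `k` and raises `l` by one, so `2 * k + l` still drops;
this explains the weight `2`. While simulating, every step moves the clock head one cell closer to a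
blank on its left. A blank met too early leads to `dead`, which has no successors. -/
theorem tableInvariant_succs (N : OracleTM) (A : Language Bool) (r : ℕ) (c : N.tableMachine.Cfg)
    (h : TableInvariant N r c) (d : N.tableMachine.Cfg) (hd : d ∈ N.tableMachine.succs A c) :
    ∃ s < r, TableInvariant N s d := by
  have hright : ∀ {clock : Turing.Tape N.Symbol} {k l : ℕ}, clock.head ≠ default →
      clock.nth k = default → clock.nth (-(l + 1 : ℕ)) = default →
      ∃ k', k = k' + 1 ∧ (clock.move Dir.right).nth k' = default ∧
        (clock.move Dir.right).nth (-(l + 1 + 1 : ℕ)) = default := by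
    intro clock k l hc hk hl
    obtain _ | k := k
    · exact absurd hk hc
    · refine ⟨k, rfl, ?_, ?_⟩ <;> rw [Turing.Tape.move_right_nth]
      · exact_mod_cast hk
      · rw [← hl]
        congr 1
  have hleft : ∀ {clock : Turing.Tape N.Symbol} {l : ℕ}, clock.head ≠ default →
      clock.nth (-l) = default →
      ∃ l', l = l' + 1 ∧ (clock.move Dir.left).nth (-l') = default := by
    intro clock l hc hl
    obtain _ | l := l
    · exact absurd hl hc
    · refine ⟨l, rfl, ?_⟩
      rw [Turing.Tape.move_left_nth, ← hl]
      congr 1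
      push_cast
      ring
  obtain ⟨q, tape, clock, table, rfl, h⟩ := h
  cases q with
  | read =>
    obtain ⟨k, l, hk, hl, rfl⟩ := h
    by_cases hc : clock.head = default
    · rw [succs_read_blank N A _ _ _ hc, Set.mem_singleton_iff] at hd
      refine ⟨l + 1, by omega, _, _, _, _, hd, l, ?_, rfl⟩
      rw [Turing.Tape.move_left_nth, ← hl]
      congr 1
      push_cast
      ring
    · rw [succs_read_ne_blank N A _ _ _ hc, Set.mem_singleton_iff] at hd
      obtain ⟨k, rfl, hk', hl'⟩ := hright hc hk hl
      exact ⟨2 * k + (l + 1) + 2, by omega, _, _, _, _, hd, k, l + 1, hk', hl', rfl⟩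
  | readBit b =>
    obtain ⟨k, l, hk, hl, rfl⟩ := h
    by_cases hc : clock.head = default
    · rw [succs_readBit_blank N A _ _ _ _ hc, Set.mem_singleton_iff] at hd
      exact ⟨0, by omega, _, _, _, _, hd, rfl⟩
    · obtain ⟨k, rfl, hk', hl'⟩ := hright hc hk hl
      refine ⟨2 * k + (l + 1) + 2, by omega, ?_⟩
      cases b
      · rw [succs_readBit_false N A _ _ _ hc, Set.mem_singleton_iff] at hd
        exact ⟨_, _, _, _, hd, k, l + 1, hk', hl', rfl⟩
      · rw [succs_readBit_true N A _ _ _ hc, Set.mem_singleton_iff] at hd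
        exact ⟨_, _, _, _, hd, k, l + 1, hk', hl', rfl⟩
  | sim q bad =>
    obtain ⟨l, hl, rfl⟩ := h
    by_cases hc : clock.head = default
    · rw [succs_sim_blank N A _ _ _ _ _ hc, Set.mem_singleton_iff] at hd
      exact ⟨0, by omega, _, _, _, _, hd, rfl⟩
    · obtain ⟨l, rfl, hl'⟩ := hleft hc hl
      refine ⟨l + 1, by omega, ?_⟩
      cases hq : N.ask q with
      | none =>
        rw [succs_sim N A _ _ _ _ _ hq hc] at hd
        obtain ⟨a, -, rfl⟩ := hd
        exact ⟨_, _, _, _, rfl, l, hl', rfl⟩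
      | some f =>
        rw [succs_sim_ask N A _ _ _ _ _ f hq hc, Set.mem_singleton_iff] at hd
        exact ⟨_, _, _, _, hd, l, hl', rfl⟩
  | back q =>
    obtain ⟨l, hl, rfl⟩ := h
    by_cases hc : clock.head = default
    · rw [succs_back_blank N A _ _ _ _ hc, Set.mem_singleton_iff] at hd
      exact ⟨0, by omega, _, _, _, _, hd, rfl⟩
    · obtain ⟨l, rfl, hl'⟩ := hleft hc hl
      refine ⟨l + 1, by omega, ?_⟩
      by_cases ht : table.head = default
      · rw [succs_back_of_blank N A _ _ _ _ hc ht, Set.mem_singleton_iff] at hd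
        exact ⟨_, _, _, _, hd, l, hl', rfl⟩
      · rw [succs_back_of_ne_blank N A _ _ _ _ hc ht, Set.mem_singleton_iff] at hd
        exact ⟨_, _, _, _, hd, l, hl', rfl⟩
  | dead =>
    rw [succs_dead] at hd
    exact absurd hd (Set.notMem_empty _)

theorem haltsWithin_tableMachine (N : OracleTM) (A : Language Bool) (w : List Bool) :
    N.tableMachine.HaltsWithin A w (2 * w.length + 2) := by
  refine haltsFrom_of_invariant (TableInvariant N) (tableInvariant_succs N A) ?_
  rw [init_tableMachine]
  refine ⟨_, _, _, _, rfl, w.length, 0, ?_, Turing.Tape.mk₁_nth_neg _ (by norm_num), rfl⟩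
  rw [Turing.Tape.mk₁_nth_nat]
  exact List.getI_eq_default _ (by simp)

end OracleTM

/-! ### Computing the table with the help of the oracle -/

namespace OracleTM

open Turing (Dir)

/-- The states of the machine that writes down a table of oracle answers and then passes control
to a machine with states `Q`.  The table is filled under the control of `k` counters, whose
directions are `δ`; the ruler, whose direction is `r`, measures the length of the queries. -/
inductive FillState (k : ℕ) (Q : Type)
  | copy
  | copyTag
  | walk (δ : Fin k → Dir) (r : Dir)
  | ask (δ : Fin k → Dir) (r : Dir)
  | answer (δ : Fin k → Dir) (r : Dir) (b : Bool)
  | tag (δ : Fin k → Dir) (r : Dir)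
  | run (q : Q)

instance {k : ℕ} {Q : Type} [Finite Q] : Finite (FillState k Q) := by
  let f : (Bool ⊕ Q) ⊕ (((Fin k → Dir) × Dir) × Option (Option (Option Bool))) → FillState k Q :=
    Sum.elim (Sum.elim (fun b => cond b .copy .copyTag) .run) (fun p => match p.2 with
      | none => .walk p.1.1 p.1.2
      | some none => .ask p.1.1 p.1.2
      | some (some none) => .tag p.1.1 p.1.2
      | some (some (some b)) => .answer p.1.1 p.1.2 b)
  refine Finite.of_surjective f fun s => ?_
  cases s with
  | copy => exact ⟨.inl (.inl true), rfl⟩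
  | copyTag => exact ⟨.inl (.inl false), rfl⟩
  | walk δ r => exact ⟨.inr ((δ, r), none), rfl⟩
  | ask δ r => exact ⟨.inr ((δ, r), some none), rfl⟩
  | answer δ r b => exact ⟨.inr ((δ, r), some (some (some b))), rfl⟩
  | tag δ r => exact ⟨.inr ((δ, r), some (some none)), rfl⟩
  | run q => exact ⟨.inl (.inr q), rfl⟩

/-- The auxiliary tapes used to fill the table. -/
inductive FillTape (k : ℕ)
  | input
  | ruler
  | counter (j : Fin k)

instance {k : ℕ} : Finite (FillTape k) := by
  refine Finite.of_surjective (fun o : Option (Option (Fin k)) => match o with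
    | none => FillTape.input
    | some none => .ruler
    | some (some j) => .counter j) fun s => ?_
  cases s with
  | input => exact ⟨none, rfl⟩
  | ruler => exact ⟨some none, rfl⟩
  | counter j => exact ⟨some (some j), rfl⟩

/-- A function on the auxiliary tapes. -/
def onFillTape {k : ℕ} {α : Type} (input ruler : α) (counter : Fin k → α) : FillTape k → α
  | .input => input
  | .ruler => ruler
  | .counter j => counter j

open Classical in
/-- Change the value of a function at the input tape. -/
noncomputable def onInput (D : OracleTM) {α : Type} (a : α) (f : D.Tape → α) : D.Tape → α :=
  fun i => if i = D.inputTape then a else f i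

open Classical in
/-- The new directions of the counters after a tick: the counters that have reached their end are
reversed, up to the first one that has not. -/
noncomputable def tickDir {k : ℕ} (blank : Fin k → Prop) (δ : Fin k → Dir) (j : Fin k) : Dir :=
  if ∀ i ≤ j, blank i then (δ j).flip else δ j

open Classical in
/-- The moves of the counters in a tick. -/
noncomputable def tickMove {k : ℕ} (blank : Fin k → Prop) (δ : Fin k → Dir) (j : Fin k) :
    Option Dir :=
  if ∀ i ≤ j, blank i then some (δ j).flip else if ∀ i < j, blank i then some (δ j) else none

open Classical in
/-- The actions of the machine that fills the table. -/
noncomputable def fillTrans (D : OracleTM) (k : ℕ) :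
    FillState k D.State → (D.Tape ⊕ FillTape k → D.Symbol) →
      Set (TMAction (FillState k D.State) D.Symbol (D.Tape ⊕ FillTape k))
  | .copy, s =>
    if s (.inr .input) = default then
      -- One mark more than the input has letters: each counter starts at `|x| + 1`, with its head
      -- on the last mark and facing left.
      {{ next := .walk (fun _ => Dir.left) Dir.right
         write := Sum.elim (fun i => s (.inl i))
          (onFillTape (s (.inr .input)) (s (.inr .ruler)) (fun _ => D.bit true))
         move := fun _ => none
         emit := none }}
    else
      {{ next := .copyTag
         write := Sum.elim (onInput D (s (.inr .input)) (fun i => s (.inl i))) (fun i => s (.inr i))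
         move := Sum.elim (onInput D (some Dir.left) (fun _ => none)) (fun _ => none)
         emit := none }}
  | .copyTag, s =>
    {{ next := .copy
       write := Sum.elim (onInput D (D.bit false) (fun i => s (.inl i)))
        (onFillTape (s (.inr .input)) (s (.inr .ruler)) (fun _ => D.bit true))
       move := Sum.elim (onInput D (some Dir.left) (fun _ => none))
        (onFillTape (some Dir.right) none (fun _ => some Dir.right))
       emit := none }}
  | .walk δ r, s =>
    if s (.inr .ruler) = default then
      -- The mark written on this blank lengthens the ruler, so the next query is longer by one.
      {{ next := .ask δ r
         write := Sum.elim (fun i => s (.inl i))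
          (onFillTape (s (.inr .input)) (D.bit true) (fun j => s (.inr (.counter j))))
         move := fun _ => none
         emit := none }}
    else
      {{ next := .walk δ r
         write := s
         move := Sum.elim (fun _ => none) (onFillTape none (some r) (fun _ => none))
         emit := some false }}
  | .ask _ _, _ => ∅
  | .answer δ r b, s =>
    {{ next := .tag δ r
       write := Sum.elim (onInput D (D.bit b) (fun i => s (.inl i))) (fun i => s (.inr i))
       move := Sum.elim (onInput D (some Dir.left) (fun _ => none)) (fun _ => none)
       emit := none }}
  | .tag δ r, s =>
    if ∀ j, s (.inr (.counter j)) = default then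
      -- The last tag is written without a move: the head stays on the first letter of the word, as
      -- an initial configuration of `D` requires.
      {{ next := .run D.start
         write := Sum.elim (onInput D (D.bit true) (fun i => s (.inl i))) (fun i => s (.inr i))
         move := fun _ => none
         emit := none }}
    else
      {{ next := .walk (tickDir (fun j => s (.inr (.counter j)) = default) δ) r.flip
         write := Sum.elim (onInput D (D.bit true) (fun i => s (.inl i))) (fun i => s (.inr i))
         move := Sum.elim (onInput D (some Dir.left) (fun _ => none))
          (onFillTape none none (tickMove (fun j => s (.inr (.counter j)) = default) δ))
         emit := none }}
  | .run q, s =>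
    (fun a =>
      { next := .run a.next
        write := Sum.elim a.write (fun i => s (.inr i))
        move := Sum.elim a.move (fun _ => none)
        emit := a.emit }) '' D.trans q (fun i => s (.inl i))

/-- The machine that writes down the input word together with a table of oracle answers, and then
runs the machine `D` on the result. -/
noncomputable def fillMachine (D : OracleTM) (k : ℕ) : OracleTM where
  State := FillState k D.State
  Symbol := D.Symbol
  Tape := D.Tape ⊕ FillTape k
  finState := haveI := D.finState; inferInstance
  finSymbol := D.finSymbol
  finTape := haveI := D.finTape; inferInstance
  blank := D.blank
  bit := D.bit
  bit_injective := D.bit_injective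
  bit_ne_blank := D.bit_ne_blank
  inputTape := .inr .input
  start := .copy
  accept := {s | ∃ q, s = .run q ∧ q ∈ D.accept}
  ask := fun s => match s with
    | .ask δ r => some (fun b => .answer δ r b)
    | _ => none
  trans := fillTrans D k

theorem fillTrans_subsingleton {D : OracleTM} (hD : D.Deterministic) (k : ℕ)
    (q : FillState k D.State) (s : D.Tape ⊕ FillTape k → D.Symbol) :
    (fillTrans D k q s).Subsingleton := by
  cases q with
  | copy => rw [fillTrans]; split_ifs <;> exact Set.subsingleton_singleton
  | copyTag => exact Set.subsingleton_singleton
  | walk δ r => rw [fillTrans]; split_ifs <;> exact Set.subsingleton_singleton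
  | ask δ r => exact Set.subsingleton_empty
  | answer δ r b => exact Set.subsingleton_singleton
  | tag δ r => rw [fillTrans]; split_ifs <;> exact Set.subsingleton_singleton
  | run q => exact (hD _ _).image _

theorem fillMachine_deterministic {D : OracleTM} (hD : D.Deterministic) (k : ℕ) :
    (D.fillMachine k).Deterministic :=
  fillTrans_subsingleton hD k

/-- A configuration of the machine that fills the table. -/
def fillCfg (D : OracleTM) (k : ℕ) (q : FillState k D.State)
    (tape : D.Tape → Turing.Tape D.Symbol) (input ruler : Turing.Tape D.Symbol)
    (counter : Fin k → Turing.Tape D.Symbol) (query : List Bool) : (D.fillMachine k).Cfg where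
  state := q
  tape := Sum.elim tape (onFillTape input ruler counter)
  query := query

theorem fillCfg_congr {D : OracleTM} {k : ℕ} {q q' : FillState k D.State}
    {tape tape' : D.Tape → Turing.Tape D.Symbol} {input input' ruler ruler' : Turing.Tape D.Symbol}
    {counter counter' : Fin k → Turing.Tape D.Symbol} {query query' : List Bool}
    (hq : q = q') (ht : ∀ i, tape i = tape' i) (hi : input = input') (hr : ruler = ruler')
    (hc : ∀ j, counter j = counter' j) (hw : query = query') :
    fillCfg D k q tape input ruler counter query =
      fillCfg D k q' tape' input' ruler' counter' query' := by
  obtain rfl : tape = tape' := funext ht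
  obtain rfl : counter = counter' := funext hc
  subst hq hi hr hw
  rfl

/-- The configuration resulting from an action of the machine that fills the table. -/
def fillAct (D : OracleTM) (k : ℕ) (tape : D.Tape → Turing.Tape D.Symbol)
    (input ruler : Turing.Tape D.Symbol) (counter : Fin k → Turing.Tape D.Symbol)
    (query : List Bool) (a : TMAction (FillState k D.State) D.Symbol (D.Tape ⊕ FillTape k)) :
    (D.fillMachine k).Cfg :=
  fillCfg D k a.next (fun i => actTape (tape i) (a.write (.inl i)) (a.move (.inl i)))
    (actTape input (a.write (.inr .input)) (a.move (.inr .input)))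
    (actTape ruler (a.write (.inr .ruler)) (a.move (.inr .ruler)))
    (fun j => actTape (counter j) (a.write (.inr (.counter j))) (a.move (.inr (.counter j))))
    (query ++ a.emit.toList)

theorem act_fillCfg (D : OracleTM) (k : ℕ) (q : FillState k D.State)
    (tape : D.Tape → Turing.Tape D.Symbol) (input ruler : Turing.Tape D.Symbol)
    (counter : Fin k → Turing.Tape D.Symbol) (query : List Bool) :
    (D.fillMachine k).act (fillCfg D k q tape input ruler counter query) =
      fillAct D k tape input ruler counter query := by
  funext a
  simp only [act, fillCfg, fillAct]
  congr 1
  funext i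
  rcases i with i | (_ | _ | j) <;> rfl

theorem succs_fillCfg (D : OracleTM) (k : ℕ) (A : Language Bool) (q : FillState k D.State)
    (hq : (D.fillMachine k).ask q = none)
    (tape : D.Tape → Turing.Tape D.Symbol) (input ruler : Turing.Tape D.Symbol)
    (counter : Fin k → Turing.Tape D.Symbol) (query : List Bool) :
    (D.fillMachine k).succs A (fillCfg D k q tape input ruler counter query) =
      fillAct D k tape input ruler counter query ''
        fillTrans D k q (Sum.elim (fun i => (tape i).head)
          (onFillTape input.head ruler.head (fun j => (counter j).head))) := by
  rw [succs_of_not_ask A hq, act_fillCfg]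
  congr 2
  funext i
  rcases i with i | (_ | _ | j) <;> rfl

theorem actTape_onInput (D : OracleTM) (b : Bool) (w : List Bool) (i : D.Tape) :
    actTape (inputBefore D w i)
        (onInput D (D.bit b) (fun i => (inputBefore D w i).head) i)
        (onInput D (some Dir.left) (fun _ => none) i) = inputBefore D (b :: w) i := by
  by_cases hi : i = D.inputTape
  · simp only [inputBefore, onInput, hi, if_true]
    exact actTape_before _ _
  · simp [inputBefore, onInput, hi]

/-! ### Transitions of the machine that fills the table. -/

section Steps

variable (D : OracleTM) (k : ℕ) (A : Language Bool) (w : List Bool)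
  (input ruler : Turing.Tape D.Symbol) (counter : Fin k → Turing.Tape D.Symbol)

theorem succs_copy_blank (h : input.head = default) :
    (D.fillMachine k).succs A (fillCfg D k .copy (inputBefore D w) input ruler counter []) =
      {fillCfg D k (.walk (fun _ => Dir.left) Dir.right) (inputBefore D w) input ruler
        (fun j => (counter j).write (D.bit true)) []} := by
  rw [succs_fillCfg D k A _ rfl]
  simp only [fillTrans, Sum.elim_inr, Sum.elim_inl, onFillTape, h, if_true, Set.image_singleton]
  refine congrArg _ (fillCfg_congr rfl (fun i => ?_) ?_ ?_ (fun j => rfl) rfl)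
  · simp
  · simp [onFillTape, ← h]
  · simp [onFillTape]

theorem succs_copy (b : Bool) (h : input.head = D.bit b) :
    (D.fillMachine k).succs A (fillCfg D k .copy (inputBefore D w) input ruler counter []) =
      {fillCfg D k .copyTag (inputBefore D (b :: w)) input ruler counter []} := by
  have hb : input.head ≠ default := h ▸ D.bit_ne_blank b
  rw [succs_fillCfg D k A _ rfl]
  simp only [fillTrans, Sum.elim_inr, Sum.elim_inl, onFillTape, hb, if_false,
    Set.image_singleton]
  refine congrArg _ (fillCfg_congr rfl (fun i => ?_) ?_ ?_ (fun j => ?_) rfl)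
  · simp only [Sum.elim_inl, h]
    exact actTape_onInput D b w i
  · simp
  · simp
  · simp

theorem succs_copyTag :
    (D.fillMachine k).succs A (fillCfg D k .copyTag (inputBefore D w) input ruler counter []) =
      {fillCfg D k .copy (inputBefore D (false :: w)) (input.move Dir.right) ruler
        (fun j => ((counter j).write (D.bit true)).move Dir.right) []} := by
  rw [succs_fillCfg D k A _ rfl]
  simp only [fillTrans, Sum.elim_inr, Sum.elim_inl, onFillTape, Set.image_singleton]
  refine congrArg _ (fillCfg_congr rfl (fun i => ?_) ?_ ?_ (fun j => rfl) rfl)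
  · exact actTape_onInput D false w i
  · simp [onFillTape]
  · simp [onFillTape]

theorem succs_walk (δ : Fin k → Dir) (r : Dir) (query : List Bool) (h : ruler.head ≠ default) :
    (D.fillMachine k).succs A
        (fillCfg D k (.walk δ r) (inputBefore D w) input ruler counter query) =
      {fillCfg D k (.walk δ r) (inputBefore D w) input (ruler.move r) counter
        (query ++ [false])} := by
  rw [succs_fillCfg D k A _ rfl]
  simp only [fillTrans, Sum.elim_inr, onFillTape, h, if_false, Set.image_singleton]
  refine congrArg _ (fillCfg_congr rfl (fun i => ?_) ?_ ?_ (fun j => ?_) rfl) <;>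
    simp [onFillTape]

theorem succs_walk_blank (δ : Fin k → Dir) (r : Dir) (query : List Bool)
    (h : ruler.head = default) :
    (D.fillMachine k).succs A
        (fillCfg D k (.walk δ r) (inputBefore D w) input ruler counter query) =
      {fillCfg D k (.ask δ r) (inputBefore D w) input (ruler.write (D.bit true)) counter
        query} := by
  rw [succs_fillCfg D k A _ rfl]
  simp only [fillTrans, Sum.elim_inr, Sum.elim_inl, onFillTape, h, if_true, Set.image_singleton]
  refine congrArg _ (fillCfg_congr rfl (fun i => ?_) ?_ rfl (fun j => ?_) ?_) <;>
    simp [onFillTape]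

theorem succs_ask (δ : Fin k → Dir) (r : Dir) (query : List Bool) (b : Bool)
    (hb : b = true ↔ query ∈ A) :
    (D.fillMachine k).succs A
        (fillCfg D k (.ask δ r) (inputBefore D w) input ruler counter query) =
      {fillCfg D k (.answer δ r b) (inputBefore D w) input ruler counter []} :=
  succs_of_ask (M := D.fillMachine k) (f := fun b => .answer δ r b) rfl hb

theorem succs_answer (δ : Fin k → Dir) (r : Dir) (b : Bool) :
    (D.fillMachine k).succs A
        (fillCfg D k (.answer δ r b) (inputBefore D w) input ruler counter []) =
      {fillCfg D k (.tag δ r) (inputBefore D (b :: w)) input ruler counter []} := by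
  rw [succs_fillCfg D k A _ rfl]
  simp only [fillTrans, Sum.elim_inr, Sum.elim_inl, Set.image_singleton]
  refine congrArg _ (fillCfg_congr rfl (fun i => ?_) ?_ ?_ (fun j => ?_) rfl)
  · exact actTape_onInput D b w i
  · simp [onFillTape]
  · simp [onFillTape]
  · simp [onFillTape]

theorem succs_tag_of_blank (δ : Fin k → Dir) (r : Dir) (h : ∀ j, (counter j).head = default) :
    (D.fillMachine k).succs A
        (fillCfg D k (.tag δ r) (inputBefore D w) input ruler counter []) =
      {fillCfg D k (.run D.start) (D.init (true :: w)).tape input ruler counter []} := by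
  rw [succs_fillCfg D k A _ rfl]
  simp only [fillTrans, Sum.elim_inr, Sum.elim_inl, onFillTape, h, implies_true, if_true,
    Set.image_singleton]
  refine congrArg _ (fillCfg_congr rfl (fun i => ?_) ?_ ?_ (fun j => ?_) rfl)
  · by_cases hi : i = D.inputTape
    · simp [inputBefore, onInput, hi, init, actTape, Turing.Tape.write_before]
    · simp [inputBefore, onInput, hi, init]
  · simp
  · simp
  · simp [← h j]

theorem succs_tag (δ : Fin k → Dir) (r : Dir) (h : ¬ ∀ j, (counter j).head = default) :
    (D.fillMachine k).succs A
        (fillCfg D k (.tag δ r) (inputBefore D w) input ruler counter []) =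
      {fillCfg D k (.walk (tickDir (fun j => (counter j).head = default) δ) r.flip)
        (inputBefore D (true :: w)) input ruler
        (fun j => actTape (counter j) (counter j).head
          (tickMove (fun j => (counter j).head = default) δ j)) []} := by
  rw [succs_fillCfg D k A _ rfl]
  simp only [fillTrans, Sum.elim_inr, Sum.elim_inl, onFillTape, h, if_false,
    Set.image_singleton]
  refine congrArg _ (fillCfg_congr rfl (fun i => ?_) ?_ ?_ (fun j => rfl) rfl)
  · exact actTape_onInput D true w i
  · simp [onFillTape]
  · simp [onFillTape]

theorem succs_run (tape : D.Tape → Turing.Tape D.Symbol) (q : D.State) (query : List Bool) :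
    (D.fillMachine k).succs A (fillCfg D k (.run q) tape input ruler counter query) =
      (fun a => fillCfg D k (.run a.next)
        (fun i => actTape (tape i) (a.write i) (a.move i)) input ruler counter
        (query ++ a.emit.toList)) '' D.trans q (fun i => (tape i).head) := by
  rw [succs_fillCfg D k A _ rfl]
  simp only [fillTrans, Sum.elim_inl]
  rw [Set.image_image]
  refine Set.image_congr fun a _ => fillCfg_congr rfl (fun i => rfl) ?_ ?_ (fun j => ?_) rfl <;>
    simp [onFillTape]

end Steps

end OracleTM

namespace OracleTM

open Turing (Dir)

/-! #### The counters -/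

open Classical in
/-- The values of the counters after a tick, when `m` is the maximal value of a counter. -/
noncomputable def tick (m : ℕ) {k : ℕ} (v : Fin k → ℕ) (j : Fin k) : ℕ :=
  if ∀ i ≤ j, v i = 0 then m else if ∀ i < j, v i = 0 then v j - 1 else v j

/-- The number with the digits `v` in base `m + 1`. -/
def counterValue (m : ℕ) : (k : ℕ) → (Fin k → ℕ) → ℕ
  | 0, _ => 0
  | k + 1, v => v 0 + (m + 1) * counterValue m k (fun j => v j.succ)

theorem counterValue_eq_zero (m : ℕ) {k : ℕ} {v : Fin k → ℕ} (h : ∀ j, v j = 0) :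
    counterValue m k v = 0 := by
  induction k with
  | zero => rfl
  | succ k ih => simp [counterValue, h 0, ih fun j => h j.succ]

theorem counterValue_max (m k : ℕ) : counterValue m k (fun _ => m) + 1 = (m + 1) ^ k := by
  induction k with
  | zero => rfl
  | succ k ih =>
    rw [counterValue, pow_succ, ← ih]
    ring

theorem tick_zero (m : ℕ) {k : ℕ} (v : Fin (k + 1) → ℕ) :
    tick m v 0 = if v 0 = 0 then m else v 0 - 1 := by
  simp [tick]

theorem tick_succ (m : ℕ) {k : ℕ} (v : Fin (k + 1) → ℕ) (j : Fin k) :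
    tick m v j.succ = if v 0 = 0 then tick m (fun j => v j.succ) j else v j.succ := by
  simp only [tick, Fin.forall_fin_succ, Fin.zero_le, forall_const, Fin.succ_le_succ_iff,
    Fin.succ_lt_succ_iff, Fin.succ_pos]
  by_cases h : v 0 = 0 <;> simp [h]

/-- A tick is subtraction of one with borrow: the leading run of zero digits turns into digits `m`,
and the first nonzero digit drops by one. -/
theorem counterValue_tick (m : ℕ) {k : ℕ} {v : Fin k → ℕ} (h : ¬ ∀ j, v j = 0) :
    counterValue m k (tick m v) + 1 = counterValue m k v := by
  induction k with
  | zero => exact absurd (fun j => j.elim0) h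
  | succ k ih =>
    simp only [counterValue, tick_zero, tick_succ]
    by_cases h0 : v 0 = 0
    · have h' : ¬ ∀ j : Fin k, v j.succ = 0 := fun h' => h (Fin.forall_fin_succ.2 ⟨h0, h'⟩)
      simp only [h0, if_true]
      rw [← ih h']
      ring
    · simp only [h0, if_false]
      omega

theorem tick_le {m k : ℕ} {v : Fin k → ℕ} (h : ∀ j, v j ≤ m) (j : Fin k) : tick m v j ≤ m := by
  have := h j
  rw [tick]
  split_ifs <;> omega

/-- The counter tapes show the values `v`. -/
def Shows {Γ : Type} [Inhabited Γ] (m : ℕ) {k : ℕ} (δ : Fin k → Dir) (v : Fin k → ℕ)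
    (counter : Fin k → Turing.Tape Γ) : Prop :=
  ∀ j, v j ≤ m ∧ (counter j).Marked (δ j) (m - v j) (v j)

theorem Shows.head_eq_iff {Γ : Type} [Inhabited Γ] {m k : ℕ} {δ : Fin k → Dir} {v : Fin k → ℕ}
    {counter : Fin k → Turing.Tape Γ} (h : Shows m δ v counter) (j : Fin k) :
    (counter j).head = default ↔ v j = 0 :=
  not_iff_not.1 (h j).2.head_ne_iff

/-- A counter tape carries exactly `m` marks, of which those not behind the head count. At value `0`
the head is on the blank beyond the block, and turning round with a single step puts all `m` marks
ahead again, so a reset needs no rewinding. -/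
theorem Shows.tick {Γ : Type} [Inhabited Γ] {m k : ℕ} {δ : Fin k → Dir} {v : Fin k → ℕ}
    {counter : Fin k → Turing.Tape Γ} (h : Shows m δ v counter) :
    Shows m (tickDir (fun j => (counter j).head = default) δ) (OracleTM.tick m v)
      (fun j => actTape (counter j) (counter j).head
        (tickMove (fun j => (counter j).head = default) δ j)) := by
  intro j
  refine ⟨tick_le (fun j => (h j).1) j, ?_⟩
  obtain ⟨hj, hm⟩ := h j
  simp only [tickDir, tickMove, OracleTM.tick, h.head_eq_iff]
  split_ifs with h₁ h₂
  · rw [h₁ j le_rfl] at hm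
    simpa using hm.move_flip
  -- All digits below `j` vanish but not all digits up to `j`, so `j` is where the borrow stops.
  · have hne : v j ≠ 0 := fun h0 => h₁ fun i hi => hi.lt_or_eq.elim (h₂ i) fun e => e ▸ h0
    obtain ⟨q, hq⟩ := Nat.exists_eq_succ_of_ne_zero hne
    rw [hq] at hm hj ⊢
    have e : m - (q.succ - 1) = m - q.succ + 1 := by omega
    rw [e, actTape_head_some]
    exact hm.move
  · rw [actTape_head_none]
    exact hm

/-! #### Filling the table -/

section Fill

variable (D : OracleTM) (k : ℕ) (A : Language Bool)

theorem init_fillMachine (x : List Bool) :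
    (D.fillMachine k).init x =
      fillCfg D k .copy (inputBefore D []) (Turing.Tape.mk₁ (x.map D.bit)) (Turing.Tape.mk₁ [])
        (fun _ => Turing.Tape.mk₁ []) [] := by
  simp only [init, fillCfg]
  congr 1
  funext i
  rcases i with i | (_ | _ | j)
  · refine (if_neg (by rintro ⟨⟩)).trans ?_
    exact (inputBefore_nil D i).symm
  · exact if_pos rfl
  · exact if_neg (by rintro ⟨⟩)
  · exact if_neg (by rintro ⟨⟩)

/-- The work tape is written from right to left, letter before tag, so each pair reads tag first and
the word comes out reversed, as in `tableWord`. Each letter also leaves one mark on every counter.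
-/
theorem detReach_copy (x w : List Bool) (L : List D.Symbol) (ruler : Turing.Tape D.Symbol)
    (counter : Fin k → Turing.Tape D.Symbol) (p : ℕ)
    (hc : ∀ j, (counter j).Marked Dir.right p 0) :
    ∃ L' counter', (∀ j, Turing.Tape.Marked Dir.right (p + x.length) 0 (counter' j)) ∧
      (D.fillMachine k).DetReach A (2 * x.length)
        (fillCfg D k .copy (inputBefore D w) (Turing.Tape.mk₂ L (x.map D.bit)) ruler counter [])
        (fillCfg D k .copy (inputBefore D (x.reverse.flatMap (fun b => [false, b]) ++ w))
          (Turing.Tape.mk₂ L' []) ruler counter' []) := by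
  induction x generalizing w L counter p with
  | nil => exact ⟨L, counter, hc, rfl⟩
  | cons b x ih =>
    obtain ⟨L', counter', hc', h⟩ := ih (false :: b :: w) (D.bit b :: L)
      (fun j => ((counter j).write (D.bit true)).move Dir.right) (p + 1)
      (fun j => (hc j).write_move (D.bit_ne_blank true))
    refine ⟨L', counter', fun j => ?_, .head (succs_copy D k A w _ ruler counter b rfl)
      (.head (succs_copyTag D k A _ _ ruler counter) (h.congr rfl ?_ ?_))⟩
    · rw [List.length_cons, Nat.add_comm x.length, ← Nat.add_assoc]
      exact hc' j
    · exact fillCfg_congr rfl (fun _ => rfl) (Turing.Tape.move_right_mk₂ _ _ _).symm rfl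
        (fun _ => rfl) rfl
    · refine fillCfg_congr rfl (fun _ => ?_) rfl rfl (fun _ => rfl) rfl
      simp

/-- The query always has as many letters as there are ruler marks behind the head. -/
theorem detReach_walk (w : List Bool) (input ruler : Turing.Tape D.Symbol)
    (counter : Fin k → Turing.Tape D.Symbol) (δ : Fin k → Dir) (r : Dir) (p q : ℕ)
    (hr : ruler.Marked r p q) :
    ∃ ruler', Turing.Tape.Marked r (p + q) 0 ruler' ∧
      (D.fillMachine k).DetReach A q
        (fillCfg D k (.walk δ r) (inputBefore D w) input ruler counter (List.replicate p false))
        (fillCfg D k (.walk δ r) (inputBefore D w) input ruler' counter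
          (List.replicate (p + q) false)) := by
  induction q generalizing ruler p with
  | zero => exact ⟨ruler, hr, rfl⟩
  | succ q ih =>
    obtain ⟨ruler', hr', h⟩ := ih (ruler.move r) (p + 1) hr.move
    rw [Nat.add_right_comm, Nat.add_assoc] at hr' h
    refine ⟨ruler', hr', .head ?_ h⟩
    rw [List.replicate_succ']
    exact succs_walk D k A w input ruler counter δ r _ (hr.head_ne_iff.2 q.succ_ne_zero)

/-- One round: the machine asks for the word `0 ⋯ 0` of length `n` and writes the answer. -/
theorem detReach_round (w : List Bool) (input ruler : Turing.Tape D.Symbol)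
    (counter : Fin k → Turing.Tape D.Symbol) (δ : Fin k → Dir) (r : Dir) (n : ℕ)
    (hr : ruler.Marked r 0 n) :
    ∃ (b : Bool) (ruler' : Turing.Tape D.Symbol), (b = true ↔ List.replicate n false ∈ A) ∧
      ruler'.Marked r.flip 0 (n + 1) ∧
      (D.fillMachine k).DetReach A (n + 3)
        (fillCfg D k (.walk δ r) (inputBefore D w) input ruler counter [])
        (fillCfg D k (.tag δ r) (inputBefore D (b :: w)) input ruler' counter []) := by
  classical
  obtain ⟨ruler', hr', h⟩ := detReach_walk D k A w input ruler counter δ r 0 n hr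
  rw [Nat.zero_add] at hr' h
  have hb : decide (List.replicate n false ∈ A) = true ↔ List.replicate n false ∈ A :=
    decide_eq_true_iff
  refine ⟨_, _, hb, hr'.write_flip (D.bit_ne_blank true), h.trans ?_⟩
  have hblank : ruler'.head = default := by
    by_contra hne
    exact hr'.head_ne_iff.1 hne rfl
  exact .head (succs_walk_blank D k A w input ruler' counter δ r _ hblank)
    (.head (succs_ask D k A w input _ counter δ r _ _ hb)
      (.single (succs_answer D k A w input _ counter δ r _)))

/-- The machine fills the table until the counters have run down. -/
theorem detReach_fill (m s n : ℕ) (w : List Bool) (input ruler : Turing.Tape D.Symbol)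
    (counter : Fin k → Turing.Tape D.Symbol) (δ : Fin k → Dir) (r : Dir) (v : Fin k → ℕ)
    (hr : ruler.Marked r 0 n) (hc : Shows m δ v counter) (hs : counterValue m k v = s) :
    ∃ (t : List Bool) (ruler' : Turing.Tape D.Symbol) (counter' : Fin k → Turing.Tape D.Symbol)
      (time : ℕ), t.length = s + 1 ∧ time ≤ (s + 1) * (n + s + 4) ∧
      (∀ (i : ℕ) (hi : i < t.length), t[i] = true ↔ List.replicate (n + i) false ∈ A) ∧
      (D.fillMachine k).DetReach A time
        (fillCfg D k (.walk δ r) (inputBefore D w) input ruler counter [])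
        (fillCfg D k (.run D.start)
          (D.init (t.reverse.flatMap (fun b => [true, b]) ++ w)).tape input ruler' counter'
          []) := by
  -- Both cases of the induction begin with this round; they differ only in what happens at the tag.
  obtain ⟨b, ruler', hb, hr', h⟩ := detReach_round D k A w input ruler counter δ r n hr
  induction s generalizing n w ruler counter δ r v b ruler' with
  | zero =>
    have hv : ∀ j, v j = 0 := by
      by_contra hv
      have := counterValue_tick m hv
      omega
    refine ⟨[b], ruler', counter, _, rfl, ?_, ?_, h.trans (.single (succs_tag_of_blank D k A _
      input ruler' counter δ r fun j => (hc.head_eq_iff j).2 (hv j)))⟩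
    · omega
    · intro i hi
      obtain rfl : i = 0 := by simpa using hi
      exact hb
  | succ s ih =>
    have hv : ¬ ∀ j, v j = 0 := by
      intro hv
      rw [counterValue_eq_zero m hv] at hs
      omega
    have hv' : ¬ ∀ j, (counter j).head = default := by
      simpa only [hc.head_eq_iff] using hv
    have htick := counterValue_tick m hv
    obtain ⟨b₁, ruler₁, hb₁, hr₁, h₁⟩ := detReach_round D k A (true :: b :: w) input ruler'
      (fun j => actTape (counter j) (counter j).head
        (tickMove (fun j => (counter j).head = default) δ j))
      (tickDir (fun j => (counter j).head = default) δ) r.flip (n + 1) hr'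
    obtain ⟨t, ruler₂, counter₂, time, hlen, htime, ht, h₂⟩ :=
      ih (n + 1) (true :: b :: w) ruler' _ _ r.flip _ hr' hc.tick (by omega) b₁ ruler₁ hb₁ hr₁ h₁
    refine ⟨b :: t, ruler₂, counter₂, _, by simp [hlen], ?_, ?_,
      (h.trans (.head (succs_tag D k A _ input ruler' counter δ r hv') h₂)).congr rfl rfl ?_⟩
    -- The round takes `n + 3` steps and the tick one; the remaining `s + 1` rounds are bounded by
    -- the induction hypothesis at `n + 1`.
    · nlinarith
    · intro i hi
      cases i with
      | zero => exact hb
      | succ i =>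
        rw [List.getElem_cons_succ, ht i (by simpa using hi), Nat.add_assoc, Nat.add_comm 1]
    · simp

/-- The machine writes down the input and a table of length `(|x| + 2) ^ k` and starts `D`. -/
theorem detReach_fillMachine (x : List Bool) :
    ∃ (t : List Bool) (input ruler : Turing.Tape D.Symbol)
      (counter : Fin k → Turing.Tape D.Symbol) (time : ℕ), t.length = (x.length + 2) ^ k ∧
      time ≤ 2 * x.length + 1 + (x.length + 2) ^ k * ((x.length + 2) ^ k + 3) ∧
      (∀ (i : ℕ) (hi : i < t.length), t[i] = true ↔ List.replicate i false ∈ A) ∧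
      (D.fillMachine k).DetReach A time ((D.fillMachine k).init x)
        (fillCfg D k (.run D.start) (D.init (tableWord x t)).tape input ruler counter []) := by
  obtain ⟨L, counter, hc, h⟩ := detReach_copy D k A x [] [] (Turing.Tape.mk₁ [])
    (fun _ => Turing.Tape.mk₁ []) 0 (fun _ => .mk₁_nil _)
  have h₁ := succs_copy_blank D k A (x.reverse.flatMap (fun b => [false, b]) ++ [])
    (Turing.Tape.mk₂ L []) (Turing.Tape.mk₁ []) counter rfl
  -- All `k` counters start at their maximum `|x| + 1`, so there are `(|x| + 2) ^ k` rounds and as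
  -- many table entries.
  have hval := counterValue_max (x.length + 1) k
  obtain ⟨t, ruler', counter', time, hlen, htime, ht, h₂⟩ := detReach_fill D k A (x.length + 1)
    _ 0 (x.reverse.flatMap (fun b => [false, b]) ++ []) (Turing.Tape.mk₂ L [])
    (Turing.Tape.mk₁ []) (fun j => (counter j).write (D.bit true)) (fun _ => Dir.left) Dir.right
    (fun _ => x.length + 1) (.mk₁_nil _) (fun j => ⟨le_rfl, by
      have := (hc j).write_flip (D.bit_ne_blank true)
      simpa [Dir.flip] using this⟩) rfl
  refine ⟨t, Turing.Tape.mk₂ L [], ruler', counter', _, by rw [hlen, hval], ?_, by simpa using ht,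
    ((h.trans (.single h₁)).trans h₂).congr rfl ?_ ?_⟩
  · rw [hval] at htime
    have e : 0 + counterValue (x.length + 1) k (fun _ => x.length + 1) + 4 =
        (x.length + 2) ^ k + 3 := by
      rw [show x.length + 2 = x.length + 1 + 1 from rfl, ← hval]
      omega
    rw [e] at htime
    exact Nat.add_le_add_left htime _
  · rw [init_fillMachine]
    rfl
  · rw [List.append_nil]
    rfl

end Fill

/-! #### The final run -/

/-- Machines with isomorphic transition graphs accept alike. -/
theorem acceptsFrom_map_iff {M N : OracleTM} {A B : Language Bool} (φ : N.Cfg → M.Cfg)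
    (hφ : ∀ c, M.succs A (φ c) = φ '' N.succs B c)
    (ha : ∀ c, (φ c).state ∈ M.accept ↔ c.state ∈ N.accept) (c : N.Cfg) :
    M.AcceptsFrom A (φ c) ↔ N.AcceptsFrom B c := by
  constructor
  · rintro ⟨n, d, hr, hd⟩
    induction n generalizing c with
    | zero =>
      obtain rfl : φ c = d := hr
      rw [hφ, Set.image_eq_empty, ha] at hd
      exact ⟨0, c, rfl, hd⟩
    | succ n ih =>
      obtain ⟨e, he, hr⟩ := hr
      rw [hφ] at he
      obtain ⟨e, he, rfl⟩ := he
      exact acceptsFrom_iff.2 (Or.inr ⟨e, he, ih e hr⟩)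
  · rintro ⟨n, d, hr, hd⟩
    induction n generalizing c with
    | zero =>
      obtain rfl : c = d := hr
      rw [← ha, ← Set.image_eq_empty (f := φ), ← hφ] at hd
      exact ⟨0, φ c, rfl, hd⟩
    | succ n ih =>
      obtain ⟨e, he, hr⟩ := hr
      refine acceptsFrom_iff.2 (Or.inr ⟨φ e, ?_, ih e hr⟩)
      rw [hφ]
      exact Set.mem_image_of_mem φ he

theorem HaltsFrom.map {M N : OracleTM} {A B : Language Bool} (φ : N.Cfg → M.Cfg)
    (hφ : ∀ c, M.succs A (φ c) = φ '' N.succs B c) {c : N.Cfg} {t : ℕ}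
    (h : N.HaltsFrom B c t) : M.HaltsFrom A (φ c) t := by
  refine haltsFrom_of_invariant (fun t d => ∃ c, φ c = d ∧ N.HaltsFrom B c t) ?_ ⟨c, rfl, h⟩
  rintro r _ ⟨c, rfl, hc⟩ d hd
  rw [hφ] at hd
  obtain ⟨e, he, rfl⟩ := hd
  cases r with
  | zero =>
    rw [hc.succs_eq_empty] at he
    exact absurd he (Set.notMem_empty _)
  | succ r => exact ⟨r, r.lt_succ_self, e, rfl, haltsFrom_succ.1 hc e he⟩

/-- The configuration in which a configuration of `D` is run. -/
def runCfg (D : OracleTM) (k : ℕ) (input ruler : Turing.Tape D.Symbol)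
    (counter : Fin k → Turing.Tape D.Symbol) (c : D.Cfg) : (D.fillMachine k).Cfg :=
  fillCfg D k (.run c.state) c.tape input ruler counter c.query

/-- Since `D` has no query states, its transitions under `A` and under any other oracle `B`
coincide; the filling tapes stay frozen. -/
theorem succs_runCfg {D : OracleTM} (hD : D.OracleFree) (k : ℕ) (A B : Language Bool)
    (input ruler : Turing.Tape D.Symbol) (counter : Fin k → Turing.Tape D.Symbol) (c : D.Cfg) :
    (D.fillMachine k).succs A (runCfg D k input ruler counter c) =
      runCfg D k input ruler counter '' D.succs B c := by
  rw [succs_of_not_ask B (hD _), Set.image_image]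
  exact succs_run D k A input ruler counter c.tape c.state c.query

theorem runCfg_accept_iff (D : OracleTM) (k : ℕ)
    (input ruler : Turing.Tape D.Symbol) (counter : Fin k → Turing.Tape D.Symbol) (c : D.Cfg) :
    (runCfg D k input ruler counter c).state ∈ (D.fillMachine k).accept ↔
      c.state ∈ D.accept := by
  constructor
  · rintro ⟨q, h, hq⟩
    injection h with h
    exact h ▸ hq
  · exact fun h => ⟨_, rfl, h⟩

/-- The base is at least `2`, so one extra factor absorbs a sum of two powers, and a coefficient `c
< 2 ^ c` is absorbed by `c` factors. -/
theorem exists_pow_bound (p : Polynomial ℕ) : ∃ k : ℕ, ∀ n : ℕ, p.eval n ≤ (n + 2) ^ k := by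
  induction p using Polynomial.induction_on' with
  | add p q hp hq =>
    obtain ⟨a, ha⟩ := hp
    obtain ⟨b, hb⟩ := hq
    refine ⟨max a b + 1, fun n => ?_⟩
    have h₁ := (ha n).trans (Nat.pow_le_pow_right (by omega) (le_max_left a b))
    have h₂ := (hb n).trans (Nat.pow_le_pow_right (by omega) (le_max_right a b))
    rw [Polynomial.eval_add, pow_succ]
    nlinarith
  | monomial d c =>
    refine ⟨c + d, fun n => ?_⟩
    rw [Polynomial.eval_monomial, pow_add]
    refine Nat.mul_le_mul ?_ (Nat.pow_le_pow_left (by omega) d)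
    exact Nat.lt_two_pow_self.le.trans (Nat.pow_le_pow_left (by omega) c)

end OracleTM

open OracleTM

/-- If `P = NP`, then tally oracles do not separate `P` from `NP`. -/
theorem classPRel_eq_classNPRel_of_isTally (h : classP = classNP) {A : Language Bool}
    (hA : IsTally A) : classPRel A = classNPRel A := by
  refine Set.Subset.antisymm (fun L ⟨M, _, hM⟩ => ⟨M, hM⟩) ?_
  rintro L ⟨N, ⟨p, hp⟩, hL⟩
  have hNP : ({w | N.tableMachine.Accepts (∅ : Set (List Bool)) w} : Language Bool) ∈ classNP := by
    refine ⟨N.tableMachine, N.tableMachine_oracleFree, ⟨2 * Polynomial.X + 2, fun w => ?_⟩,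
      fun w => Iff.rfl⟩
    simpa using haltsWithin_tableMachine N (∅ : Set (List Bool)) w
  rw [← h] at hNP
  obtain ⟨D, hfree, hdet, ⟨q, hq⟩, hD⟩ := hNP
  -- `2 * p + 1` is the table length demanded by `accepts_tableMachine_iff` for running time `p`.
  obtain ⟨k, hk⟩ := exists_pow_bound (2 * p + 1)
  -- The time bound adds the cost of copying and filling to that of `D` on a word of length `2 *
  -- (|x| + 2) ^ k + 2 * |x|`.
  refine ⟨D.fillMachine k, fillMachine_deterministic hdet k, ⟨2 * Polynomial.X + 1 +
    (Polynomial.X + 2) ^ k * ((Polynomial.X + 2) ^ k + 3) +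
    q.comp (2 * (Polynomial.X + 2) ^ k + 2 * Polynomial.X), fun x => ?_⟩, fun x => ?_⟩ <;>
  obtain ⟨t, input, ruler, counter, time, hlen, htime, ht, hr⟩ := detReach_fillMachine D k A x
  · have hrun := HaltsFrom.map _ (succs_runCfg hfree k A (∅ : Set (List Bool)) input ruler counter)
      (hq (tableWord x t))
    refine (hr.haltsFrom hrun).mono ?_
    rw [length_tableWord, hlen]
    simpa using htime
  · have hk' := hk x.length
    have hN := accepts_tableMachine_iff N hA (∅ : Set (List Bool)) x t _ (hp x)
      (by rw [hlen]; simpa using hk') ht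
    have hrun := acceptsFrom_map_iff _
      (succs_runCfg hfree k A (∅ : Set (List Bool)) input ruler counter)
      (runCfg_accept_iff D k input ruler counter) (D.init (tableWord x t))
    rw [hL x, ← hN]
    exact (hD (tableWord x t)).trans (hrun.symm.trans hr.acceptsFrom_iff.symm)

theorem mainTheorem3 (e : ℕ ≃ List Bool)
    (hO : RamseyLarge {S : EllentuckSpace | oracleOf e S ∈ separatingOracles}) :
    classP ≠ classNP := by
  intro h
  have hinf : (Set.range fun n => e.symm (List.replicate n false)).Infinite :=
    Set.infinite_range_of_injective fun m n hmn => by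
      simpa using congrArg List.length (e.symm.injective hmn)
  -- Every infinite subset of this range codes a tally oracle; one of them is separating.
  obtain ⟨S, hS, hsub⟩ := hO.exists_subset hinf
  refine hS (classPRel_eq_classNPRel_of_isTally h ?_)
  rintro _ ⟨i, hi, rfl⟩
  obtain ⟨n, rfl⟩ := hsub hi
  simp
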